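/- **Cellular algebras.** Let $R$ be an integral domain with fraction field $\mathbb F$. A cell datum of a unital $R$-algebra $A$ consists of an $R$-linear involutive anti-automorphism $*$, a finite poset $(\widehat A,\unrhd)$, finite index sets $\mathrm{Std}(\lambda)$ ($\lambda\in\widehat A$) and an $R$-basis $\{c^\lambda_{st}\}$ ($\lambda \in \widehat A$, $s,t\in\mathrm{Std}(\lambda)$) of $A$ such that, with $A^{\rhd\lambda}=\mathrm{span}_R\{c^\mu_{pq}:\mu\rhd\lambda\}$, (a) $c^\lambda_{st}a\equiv\sum_v r(a;t,v)\,c^\lambda_{sv}$ mod $A^{\rhd\lambda}$ with $r(a;t,v)\in R$ independent of $s$, and (b) $(c^\lambda_{st})^*\equiv c^\lambda_{ts}$ mod $A^{\rhd\lambda}$. The cell module $\Delta(\lambda)$ is free on $\{c_t\}_{t\in\mathrm{Std}(\lambda)}$ with $c_ta=\sum_v r(a;t,v)c_v$. **Sequences of diagram algebras.** Let $A_0\subseteq A_1\subseteq\cdots$ be $R$-algebras with cell data (posets $\widehat A_r$, non-empty index sets, cell modules $\Delta_r(\lambda)$), with unital inclusions and consistent involutions, such that: (D1) $A_0=R$.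 (D2) Every $\Delta_r(\lambda)$ is cyclic, with a fixed generator $\delta(\lambda)=\sum_s x_sc_s$; fix a cell generator $m_\lambda\in A_r$ with $m_\lambda\equiv\sum_{s,t}x_sx_t\,c^\lambda_{st}$ mod $A_r^{\rhd\lambda}$. (D3) $m_\lambda^*=m_\lambda$. (D4) $A_r\otimes_R\mathbb F$ is split semisimple. (D5) For $\mu\in\widehat A_{r+1}$ the restriction of $\Delta_{r+1}(\mu)$ to $A_r$ has a filtration $0=M_0\subseteq\cdots\subseteq M_n$ by $A_r$-submodules with $M_i/M_{i-1}\cong\Delta_r(\lambda^{(i)})$ and $\lambda^{(1)}\rhd\lambda^{(2)}\rhd\cdots$. Write $\lambda\to\mu$ if $\lambda$ is one of the $\lambda^{(i)}$. For each edge $\lambda=\lambda^{(i)}\to\mu$ fix $d_{\lambda\to\mu}\in A_{r+1}$ such that $\delta(\mu)d_{\lambda\to\mu}\in M_i$ represents the generator $\delta(\lambda)$ of $M_i/M_{i-1}\cong\Delta_r(\lambda)$. (D6) For each edge $\lambda\to\mu$ there is $u_{\lambda\to\mu}\in A_{r+1}$ with $m_\mu d_{\lambda\to\mu}=u_{\lambda\to\mu}^*m_\lambda$.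 From here on, $\mathrm{Std}_r(\lambda)$ is the set of directed paths $t=(t(0)\to\cdots\to t(r)=\lambda)$ with $t(k)\in\widehat A_k$. For a path $t$ from level $i$ to level $j$ put $d_t=d_{t(j-1)\to t(j)}\cdots d_{t(i)\to t(i+1)}$, and for $s,t\in\mathrm{Std}_r(\lambda)$ put $m^\lambda_{st}=d_s^*m_\lambda d_t$. **Quotient towers.** Let $\pi:R\to S$ be a surjective homomorphism of integral domains, $\mathbb K=\mathrm{Frac}(S)$, $A_r^S=A_r\otimes_RS\subseteq A_r^{\mathbb K}=A_r\otimes_R\mathbb K$, with the involutions induced by $*$. Let $Q_0^{\mathbb K}\subseteq Q_1^{\mathbb K}\subseteq\cdots$ be unital $\mathbb K$-algebras with common identity, $\phi_r:A_r^{\mathbb K}\to Q_r^{\mathbb K}$ surjective homomorphisms compatible with the inclusions, and $Q_r^S=\phi_r(A_r^S)$. Assume: (Q1) Certain points of $\widehat A_r$ are called permissible; the point of $\widehat A_0$ is permissible; each permissible $\mu\in\widehat A_r$ has an edge $\mu\to\nu$ with $\nu$ permissible and, if $r\ge1$, an edge $\lambda\to\mu$ with $\lambda$ permissible. A path is permissible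 if all its points are. A point $\mu\in\widehat A_k$ is marginal if it is not permissible but is the end of a path in $\mathrm{Std}_k(\mu)$ whose other points are permissible; these are exactly the points that occur as the first nonpermissible point of a path. (Q2) For each marginal $\mu\in\widehat A_k$ there are given $\mathfrak b_\mu,\mathfrak b'_\mu\in A_k^S$ with $m_\mu=\mathfrak b_\mu-\mathfrak b'_\mu$, $\mathfrak b_\mu\in\ker\phi_k$ and $\mathfrak b'_\mu\in m_\mu A_k^{\mathbb K}\cap(A_k^S)^{\rhd\mu}$. (Q3) With $\overline{\mathbb K}$ the algebraic closure of $\mathbb K$, $\dim_{\overline{\mathbb K}}(Q_r^{\mathbb K}\otimes_{\mathbb K}\overline{\mathbb K})=\sum_\nu p_\nu^2$ for all $r$, where $\nu$ runs over the permissible points of $\widehat A_r$ and $p_\nu$ is the number of permissible paths in $\mathrm{Std}_r(\nu)$. **Modified elements.** For marginal $\mu\in\widehat A_k$ choose $\beta_\mu\in A_k^{\mathbb K}$ with $\mathfrak b_\mu=m_\mu\beta_\mu$. For a permissible path $t$ put $a_t=d_t$; if $t\in\mathrm{Std}_r(\lambda)$ is not permissible and $\mu=t(k)$ is its first nonpermissible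 point, put $a_t=d_{t_2}\beta_\mu d_{t_1}\in A_r^{\mathbb K}$ with $t_1=t_{[0,k]}$, $t_2=t_{[k,r]}$. Put $\tilde m^\lambda_{st}=a_s^*m_\lambda a_t\in A_r^{\mathbb K}$. Put $\hat m^\lambda_{st}=d_s^*m_\lambda a_t$ if neither $s$ nor $t$ is permissible, and $\hat m^\lambda_{st}=\tilde m^\lambda_{st}$ otherwise. **Theorem.** For all $r\ge0$: 1. $\ker\phi_r$, both in $A_r^{\mathbb K}$ and in $A_r^S$, is invariant under $*$. Hence $\phi_r(a)^*=\phi_r(a^*)$ defines an involution on $Q_r^S$. 2. $Q_r^S$ is a cellular algebra over $S$, with cell datum given by this involution, the poset of permissible points $\lambda\in\widehat A_r$, the sets of permissible paths in $\mathrm{Std}_r(\lambda)$, and the basis $\{\phi_r(m^\lambda_{st})\}$ for $\lambda$ permissible and $s,t\in\mathrm{Std}_r(\lambda)$ permissible. 3. The elements $\hat m^\lambda_{st}$ with $\lambda\in\widehat A_r$ and $s$ or $t$ not permissible lie in $A_r^S$ and form an $S$-basis of $\ker\phi_r\cap A_r^S$. The elements $\tilde m^\lambda_{st}$ with $s$ or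 $t$ not permissible form a $\mathbb K$-basis of $\ker\phi_r\subseteq A_r^{\mathbb K}$, and if they all lie in $A_r^S$, then they form an $S$-basis of $\ker\phi_r\cap A_r^S$. 4. $\ker\phi_r\cap A_r^S$ is the two-sided ideal of $A_r^S$ generated by the elements $\mathfrak b_\mu$, where $\mu$ runs over the marginal points of $\widehat A_k$ for $0<k\le r$. -/

import Mathlib

open scoped TensorProduct

/-- A cell datum for the unital `R`-algebra `A`, with finite poset `Λ` (`μ ⊵ lam` is written
`lam ≤ μ`) and finite index sets `T lam`. `coef lam a t v` is the coefficient `r(a; t, v)`; it does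
not depend on `s`. -/
structure CellDatum (R : Type*) [CommRing R] (A : Type*) [Ring A] [Algebra R A]
    (Λ : Type*) [PartialOrder Λ] [Finite Λ] (T : Λ → Type*) [∀ lam, Finite (T lam)] where
  star : A →ₗ[R] A
  star_mul : ∀ x y, star (x * y) = star y * star x
  star_star : ∀ x, star (star x) = x
  basis : Module.Basis (Σ lam : Λ, T lam × T lam) R A
  coef : ∀ lam : Λ, A → T lam → (T lam →₀ R)
  mul_coef : ∀ (lam : Λ) (a : A) (s t : T lam),
    basis ⟨lam, s, t⟩ * a
        - Finsupp.linearCombination R (fun v => basis ⟨lam, s, v⟩) (coef lam a t) ∈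
      Submodule.span R {x | ∃ μ, lam < μ ∧ ∃ p q : T μ, x = basis ⟨μ, p, q⟩}
  star_basis : ∀ (lam : Λ) (s t : T lam),
    star (basis ⟨lam, s, t⟩) - basis ⟨lam, t, s⟩ ∈
      Submodule.span R {x | ∃ μ, lam < μ ∧ ∃ p q : T μ, x = basis ⟨μ, p, q⟩}

namespace CellDatum

variable {R : Type*} [CommRing R] {A : Type*} [Ring A] [Algebra R A]
  {Λ : Type*} [PartialOrder Λ] [Finite Λ] {T : Λ → Type*} [∀ lam, Finite (T lam)]

/-- The basis element `c^lam_{st}`. -/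
noncomputable def c (D : CellDatum R A Λ T) (lam : Λ) (s t : T lam) : A := D.basis ⟨lam, s, t⟩

/-- The ideal `A^{▷ lam}`, as an `R`-module. -/
def above (D : CellDatum R A Λ T) (lam : Λ) : Submodule R A :=
  Submodule.span R {x | ∃ μ, lam < μ ∧ ∃ p q : T μ, x = D.basis ⟨μ, p, q⟩}

/-- The right action of `a` on the cell module `Δ(lam)`, the free module on `T lam`:
`c_t a = ∑ v, r(a; t, v) c_v`. -/
noncomputable def act (D : CellDatum R A Λ T) (lam : Λ) (a : A) :
    (T lam →₀ R) →ₗ[R] (T lam →₀ R) :=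
  Finsupp.linearCombination R (D.coef lam a)

/-- The representative `∑ x_s y_t c^lam_{st}` in `A` of the class that corresponds to `x^* ⊗ y`
under the isomorphism `A^{⊵ lam} / A^{▷ lam} ≅ Δ(lam)^* ⊗ Δ(lam)`. -/
noncomputable def lift (D : CellDatum R A Λ T) (lam : Λ) (x y : T lam →₀ R) : A :=
  x.sum fun s p => y.sum fun t q => (p * q) • D.c lam s t

end CellDatum

/-- A finite-dimensional algebra over a field that is a product of matrix algebras. -/
def IsSplitSemisimple (F : Type*) [Field F] (B : Type*) [Ring B] [Algebra F B] : Prop :=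
  ∃ (n : ℕ) (d : Fin n → ℕ), (∀ i, d i ≠ 0) ∧
    Nonempty (B ≃ₐ[F] (∀ i, Matrix (Fin (d i)) (Fin (d i)) F))

/-- An increasing sequence of cellular algebras with unital inclusions and consistent
involutions. -/
structure CellTower (R : Type*) [CommRing R] (A : ℕ → Type*) [∀ r, Ring (A r)]
    [∀ r, Algebra R (A r)] (Λ : ℕ → Type*) [∀ r, PartialOrder (Λ r)] [∀ r, Finite (Λ r)]
    (T : ∀ r, Λ r → Type*) [∀ r lam, Finite (T r lam)] where
  datum : ∀ r, CellDatum R (A r) (Λ r) (T r)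
  incl : ∀ r, A r →ₐ[R] A (r + 1)
  incl_injective : ∀ r, Function.Injective (incl r)
  incl_star : ∀ r a, (datum (r + 1)).star (incl r a) = incl r ((datum r).star a)

namespace CellTower

variable {R : Type*} [CommRing R] {A : ℕ → Type*} [∀ r, Ring (A r)]
  [∀ r, Algebra R (A r)] {Λ : ℕ → Type*} [∀ r, PartialOrder (Λ r)] [∀ r, Finite (Λ r)]
  {T : ∀ r, Λ r → Type*} [∀ r lam, Finite (T r lam)]

/-- An order preserving cell filtration `0 = M_0 ⊆ M_1 ⊆ ⋯ ⊆ M_n` of the restriction of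
`Δ_{r+1}(μ)` to `A_r`. The isomorphism of `A_r`-modules from `M_{i+1} / M_i` to the cell module of
`label i` is given as a surjective equivariant map `quo i` on `M_{i+1}` with kernel `M_i`. -/
structure CellFiltration (C : CellTower R A Λ T) (r : ℕ) (μ : Λ (r + 1)) where
  n : ℕ
  label : Fin n → Λ r
  label_anti : ∀ i j, i < j → label j < label i
  sub : Fin (n + 1) → Submodule R (T (r + 1) μ →₀ R)
  sub_zero : sub 0 = ⊥
  sub_last : sub (Fin.last n) = ⊤
  sub_le : ∀ i : Fin n, sub i.castSucc ≤ sub i.succ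
  sub_act : ∀ i (a : A r) x, x ∈ sub i → (C.datum (r + 1)).act μ (C.incl r a) x ∈ sub i
  quo : ∀ i : Fin n, sub i.succ →ₗ[R] (T r (label i) →₀ R)
  quo_surjective : ∀ i, Function.Surjective (quo i)
  quo_eq_zero : ∀ i x, quo i x = 0 ↔ x.1 ∈ sub i.castSucc
  quo_act : ∀ (i : Fin n) (a : A r) (x : sub i.succ),
    quo i ⟨(C.datum (r + 1)).act μ (C.incl r a) x.1, sub_act _ a _ x.2⟩ =
      (C.datum r).act (label i) a (quo i x)

/-- The edges `lam → μ` of the branching diagram. -/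
def Edge (C : CellTower R A Λ T) {r : ℕ} (lam : Λ r) (μ : Λ (r + 1)) : Prop :=
  ∃ (M : C.CellFiltration r μ) (i : Fin M.n), M.label i = lam

/-- `C.Path r lam` is `Std_r(lam)`: the directed paths on the branching diagram from level `0`
to `lam`. -/
inductive Path (C : CellTower R A Λ T) : (r : ℕ) → Λ r → Type _
  | nil (lam : Λ 0) : Path C 0 lam
  | cons {r : ℕ} {lam : Λ r} {μ : Λ (r + 1)} (t : Path C r lam) (e : C.Edge lam μ) :
      Path C (r + 1) μ

instance Path.instFinite (C : CellTower R A Λ T) : ∀ (r : ℕ) (lam : Λ r), Finite (C.Path r lam)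
  | 0, lam => by
    refine Finite.of_injective (fun _ => ()) ?_
    rintro ⟨_⟩ ⟨_⟩ _
    rfl
  | r + 1, μ => by
    have := Path.instFinite C r
    refine Finite.of_injective
      (fun t : C.Path (r + 1) μ => (match t with
        | .cons (lam := lam) t _ => ⟨lam, t⟩ : Σ lam : Λ r, C.Path r lam)) ?_
    rintro (_ | ⟨t, e⟩) (_ | ⟨t', e'⟩) h
    simp only [Sigma.mk.injEq] at h
    obtain ⟨rfl, h⟩ := h
    cases h
    rfl

/-- All points of the path lie in `P`. -/
def Path.Perm {C : CellTower R A Λ T} (P : ∀ r, Set (Λ r)) :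
    ∀ {r : ℕ} {lam : Λ r}, C.Path r lam → Prop
  | _, _, .nil lam => lam ∈ P 0
  | _, _, .cons (μ := μ) t _ => t.Perm P ∧ μ ∈ P _

/-- A marginal point for the set `P` of permissible points: `μ` is not permissible, and some path
to `μ` has all its points before `μ` permissible. -/
def IsMarginal (C : CellTower R A Λ T) (P : ∀ r, Set (Λ r)) (r : ℕ) (μ : Λ (r + 1)) : Prop :=
  μ ∉ P (r + 1) ∧ ∃ (lam : Λ r) (t : C.Path r lam), C.Edge lam μ ∧ t.Perm P

end CellTower

/-- A sequence of diagram algebras, with chosen generators `δ` of the cell modules,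
cell generators `m`, down-branching factors `d` and up-branching factors `u`. -/
structure DiagramTower (R : Type*) [CommRing R] [IsDomain R] (A : ℕ → Type*) [∀ r, Ring (A r)]
    [∀ r, Algebra R (A r)] (Λ : ℕ → Type*) [∀ r, PartialOrder (Λ r)] [∀ r, Finite (Λ r)]
    (T : ∀ r, Λ r → Type*) [∀ r lam, Finite (T r lam)] extends CellTower R A Λ T where
  nonempty_index : ∀ r lam, Nonempty (T r lam)
  /-- `A_0 = R`. -/
  level_zero : Function.Bijective (algebraMap R (A 0))
  δ : ∀ r (lam : Λ r), T r lam →₀ R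
  /-- Every cell module is cyclic, generated by `δ`. -/
  δ_cyclic : ∀ r lam x, ∃ a : A r, (datum r).act lam a (δ r lam) = x
  m : ∀ r, Λ r → A r
  /-- `m_lam` represents `δ^* ⊗ δ` modulo `A^{▷ lam}`. -/
  m_spec : ∀ r lam, m r lam - (datum r).lift lam (δ r lam) (δ r lam) ∈ (datum r).above lam
  m_star : ∀ r lam, (datum r).star (m r lam) = m r lam
  split_semisimple : ∀ r, IsSplitSemisimple (FractionRing R) (FractionRing R ⊗[R] A r)
  restriction_coherent : ∀ r μ, Nonempty (toCellTower.CellFiltration r μ)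
  d : ∀ r, Λ r → Λ (r + 1) → A (r + 1)
  /-- `δ(μ) d_{lam → μ}` lies in the step of the cell filtration that belongs to `lam`, and
  represents there the generator `δ(lam)` of the subquotient `Δ(lam)`. -/
  d_spec : ∀ r lam μ, toCellTower.Edge lam μ →
    ∃ (M : toCellTower.CellFiltration r μ) (i : Fin M.n), M.label i = lam ∧
      ∃ h : (datum (r + 1)).act μ (d r lam μ) (δ (r + 1) μ) ∈ M.sub i.succ,
        M.quo i ⟨_, h⟩ = δ r (M.label i)
  u : ∀ r, Λ r → Λ (r + 1) → A (r + 1)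
  compat : ∀ r lam μ, toCellTower.Edge lam μ →
    m (r + 1) μ * d r lam μ = (datum (r + 1)).star (u r lam μ) * incl r (m r lam)

namespace DiagramTower

variable {R : Type*} [CommRing R] [IsDomain R] {A : ℕ → Type*} [∀ r, Ring (A r)]
  [∀ r, Algebra R (A r)] {Λ : ℕ → Type*} [∀ r, PartialOrder (Λ r)] [∀ r, Finite (Λ r)]
  {T : ∀ r, Λ r → Type*} [∀ r lam, Finite (T r lam)]

/-- The ordered product `d_t = d_{t(r-1) → t(r)} ⋯ d_{t(0) → t(1)}`. -/
def dPath (D : DiagramTower R A Λ T) : ∀ {r : ℕ} {lam : Λ r}, D.Path r lam → A r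
  | _, _, .nil _ => 1
  | _, _, .cons (r := r) (lam := lam) (μ := μ) t _ => D.d r lam μ * D.incl r (D.dPath t)

/-- The Murphy basis element `m^lam_{st} = d_s^* m_lam d_t`. -/
def murphy (D : DiagramTower R A Λ T) {r : ℕ} {lam : Λ r} (s t : D.Path r lam) : A r :=
  (D.datum r).star (D.dPath s) * D.m r lam * D.dPath t

/-- The specialized inclusion `A_r^S → A_{r+1}^S`. -/
noncomputable def inclBase (D : DiagramTower R A Λ T) (S : Type*) [CommRing S] [Algebra R S]
    (r : ℕ) : S ⊗[R] A r →ₐ[S] S ⊗[R] A (r + 1) :=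
  Algebra.TensorProduct.map (AlgHom.id S S) (D.incl r)

/-- The specialized involution on `A_r^S`. -/
noncomputable def starBase (D : DiagramTower R A Λ T) (S : Type*) [CommRing S] [Algebra R S]
    (r : ℕ) : S ⊗[R] A r →ₗ[S] S ⊗[R] A r :=
  (D.datum r).star.baseChange S

/-- `(A_r^S)^{▷ lam}`. -/
noncomputable def aboveBase (D : DiagramTower R A Λ T) (S : Type*) [CommRing S] [Algebra R S]
    (r : ℕ) (lam : Λ r) : Submodule S (S ⊗[R] A r) :=
  ((D.datum r).above lam).baseChange S

end DiagramTower

/-- The map `A^S → A^K` of specializations. -/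
noncomputable def specMap (R S K B : Type*) [CommRing R] [CommRing S] [Field K] [Algebra R S]
    [Algebra R K] [Algebra S K] [IsScalarTower R S K] [Ring B] [Algebra R B] :
    S ⊗[R] B →ₐ[S] K ⊗[R] B :=
  Algebra.TensorProduct.map (Algebra.ofId S K) (AlgHom.id R B)

/-- A quotient tower of a specialization `A_r^S` of a sequence of diagram algebras, with
maps `φ_r : A_r^K → Q_r^K`, a set `perm r` of permissible points for each `r`, and chosen
elements `𝔟_μ`, `𝔟'_μ` in `A_k^S`. The points `μ` that occur as the first nonpermissible point
of some nonpermissible path are exactly the marginal points; none of them has level `0`. -/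
structure QuotientTower {R : Type*} [CommRing R] [IsDomain R] {A : ℕ → Type*} [∀ r, Ring (A r)]
    [∀ r, Algebra R (A r)] {Λ : ℕ → Type*} [∀ r, PartialOrder (Λ r)] [∀ r, Finite (Λ r)]
    {T : ∀ r, Λ r → Type*} [∀ r lam, Finite (T r lam)] (D : DiagramTower R A Λ T)
    (S K : Type*) [CommRing S] [Field K] [Algebra R S] [Algebra R K]
    [Algebra S K] [IsScalarTower R S K]
    (Q : ℕ → Type*) [∀ r, Ring (Q r)] [∀ r, Algebra K (Q r)] where
  incl : ∀ r, Q r →ₐ[K] Q (r + 1)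
  incl_injective : ∀ r, Function.Injective (incl r)
  φ : ∀ r, K ⊗[R] A r →ₐ[K] Q r
  φ_surjective : ∀ r, Function.Surjective (φ r)
  φ_incl : ∀ r x, φ (r + 1) (D.inclBase K r x) = incl r (φ r x)
  perm : ∀ r, Set (Λ r)
  perm_zero : ∀ lam : Λ 0, lam ∈ perm 0
  perm_up : ∀ r, ∀ μ ∈ perm r, ∃ ν ∈ perm (r + 1), D.Edge μ ν
  perm_down : ∀ r, ∀ μ ∈ perm (r + 1), ∃ lam ∈ perm r, D.Edge lam μ
  𝔟 : ∀ k, Λ (k + 1) → S ⊗[R] A (k + 1)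
  𝔟' : ∀ k, Λ (k + 1) → S ⊗[R] A (k + 1)
  m_eq : ∀ k μ, D.IsMarginal perm k μ → 1 ⊗ₜ[R] D.m (k + 1) μ = 𝔟 k μ - 𝔟' k μ
  φ_𝔟 : ∀ k μ, D.IsMarginal perm k μ → φ (k + 1) (specMap R S K _ (𝔟 k μ)) = 0
  𝔟'_mem_mul : ∀ k μ, D.IsMarginal perm k μ →
    ∃ y : K ⊗[R] A (k + 1), specMap R S K _ (𝔟' k μ) = 1 ⊗ₜ[R] D.m (k + 1) μ * y
  𝔟'_mem_above : ∀ k μ, D.IsMarginal perm k μ → 𝔟' k μ ∈ D.aboveBase S (k + 1) μ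
  finrank_eq : ∀ r,
    Module.finrank (AlgebraicClosure K) (AlgebraicClosure K ⊗[K] Q r) =
      ∑ᶠ ν ∈ perm r, Nat.card {t : D.Path r ν // t.Perm perm} ^ 2

namespace QuotientTower

variable {R : Type*} [CommRing R] [IsDomain R] {A : ℕ → Type*} [∀ r, Ring (A r)]
  [∀ r, Algebra R (A r)] {Λ : ℕ → Type*} [∀ r, PartialOrder (Λ r)] [∀ r, Finite (Λ r)]
  {T : ∀ r, Λ r → Type*} [∀ r lam, Finite (T r lam)] {D : DiagramTower R A Λ T}
  {S K : Type*} [CommRing S] [Field K] [Algebra R S] [Algebra R K]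
  [Algebra S K] [IsScalarTower R S K]
  {Q : ℕ → Type*} [∀ r, Ring (Q r)] [∀ r, Algebra K (Q r)]

/-- The restriction of `φ_r` to `A_r^S`; its range is `Q_r^S`. -/
noncomputable def φS (W : QuotientTower D S K Q) [∀ r, Algebra S (Q r)]
    [∀ r, IsScalarTower S K (Q r)] (r : ℕ) : S ⊗[R] A r →ₐ[S] Q r :=
  ((W.φ r).restrictScalars S).comp (specMap R S K (A r))

/-- The permissible paths `Std_{r,perm}(lam)`. -/
abbrev PermPath (W : QuotientTower D S K Q) (r : ℕ) (lam : Λ r) : Type _ :=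
  {t : D.Path r lam // t.Perm W.perm}

/-- The triples `(lam, s, t)` with `s` or `t` not permissible. -/
abbrev NonpermPair (W : QuotientTower D S K Q) (r : ℕ) : Type _ :=
  {i : Σ lam : Λ r, D.Path r lam × D.Path r lam //
    ¬ (i.2.1.Perm W.perm ∧ i.2.2.Perm W.perm)}

open Classical in
/-- The element `a_t` of `A_r^K`: it is `d_t` if `t` is permissible, and `d_{t₂} β_μ d_{t₁}` if
`μ = t(k)` is the first nonpermissible point of `t`, with `t₁ = t_{[0,k]}` and
`t₂ = t_{[k,r]}`. -/
noncomputable def aPath (W : QuotientTower D S K Q) (β : ∀ k, Λ (k + 1) → K ⊗[R] A (k + 1)) :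
    ∀ {r : ℕ} {lam : Λ r}, D.Path r lam → K ⊗[R] A r
  | _, _, .nil _ => 1
  | _, _, .cons (r := r) (lam := lam) (μ := μ) t e =>
    if t.Perm W.perm then
      if μ ∈ W.perm (r + 1) then 1 ⊗ₜ[R] D.dPath (.cons t e)
      else β r μ * 1 ⊗ₜ[R] D.dPath (.cons t e)
    else 1 ⊗ₜ[R] D.d r lam μ * D.inclBase K r (W.aPath β t)

/-- The element `a_s^* m_lam a_t` of `A_r^K`. -/
noncomputable def mTilde (W : QuotientTower D S K Q) (β : ∀ k, Λ (k + 1) → K ⊗[R] A (k + 1))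
    {r : ℕ} {lam : Λ r} (s t : D.Path r lam) : K ⊗[R] A r :=
  D.starBase K r (W.aPath β s) * 1 ⊗ₜ[R] D.m r lam * W.aPath β t

open Classical in
/-- The element `d_s^* m_lam a_t` if neither `s` nor `t` is permissible, and
`a_s^* m_lam a_t` otherwise. -/
noncomputable def mHat (W : QuotientTower D S K Q) (β : ∀ k, Λ (k + 1) → K ⊗[R] A (k + 1))
    {r : ℕ} {lam : Λ r} (s t : D.Path r lam) : K ⊗[R] A r :=
  if ¬ s.Perm W.perm ∧ ¬ t.Perm W.perm then
    D.starBase K r (1 ⊗ₜ[R] D.dPath s) * 1 ⊗ₜ[R] D.m r lam * W.aPath β t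
  else W.mTilde β s t

/-- The images in `A_r^S` of the elements `𝔟_μ` for the marginal points `μ` of level `s`, for all
`0 < s ≤ r`. -/
def marginalSet (W : QuotientTower D S K Q) : ∀ r : ℕ, Set (S ⊗[R] A r)
  | 0 => ∅
  | r + 1 => D.inclBase S r '' W.marginalSet r ∪
      {x | ∃ μ : Λ (r + 1), D.IsMarginal W.perm r μ ∧ x = W.𝔟 r μ}

end QuotientTower

/-!
The cellular structure of the quotient tower and the description of the kernels of `φ_r` rest on
the Murphy basis `m^lam_{st} = d_s^* m_lam d_t` of `A_r`, and on a modification of it in which the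
members with a nonpermissible path fall into the kernel.

*The Murphy basis.* In a semisimple algebra every left ideal has a right identity. Applied to the
ideals `A^{▷ lam}` and `A^{⊵ lam}` over the fraction field, this gives elements of `A_r` that act as
a nonzero scalar on the cell modules with label in a given upper set and as zero on all others
(`CellDatum.exists_separating`). The steps of a cell filtration are eigenspaces of these elements
(`CellTower.CellFiltration.mem_sub_iff`), so neither the steps nor the labels depend on the
filtration, and one filtration serves all down-branching factors
(`DiagramTower.exists_adapted`). By induction on the level, the vectors `δ(lam) d_t` form a basis of
`Δ(lam)`. Since `x^* m_lam y` depends modulo `A^{▷ lam}` only on `δ(lam) x` and `δ(lam) y`, the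
elements `m^lam_{st}` are block unitriangular in the given cell basis. All of this survives
extension of scalars.

*Triangularity.* As `𝔟'_μ` lies in `A^{▷ μ}`, the factor `β_μ` does not change `δ(μ)`. It follows
that `δ(lam) a_t` is `δ(lam) d_t` plus a combination of vectors `δ(lam) d_v` with `v` larger than
`t` in a reverse lexicographic order (`QuotientTower.coordBase_aPath_sub_mem`). Hence the elements
`m̃^lam_{st}` form a basis of `A_r^K`. The factorization `m_lam a_t = u_{t₂}^* 𝔟_μ d_{t₁}` shows
that the coordinates of `δ(lam) a_t` lie in `S`, and that the elements `m̂^lam_{st}` form a basis of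
`A_r^S`.

*The kernel.* The factorization also shows that `m_lam a_t` lies in the ideal generated by the
elements `𝔟_μ` if `t` is not permissible. The point is to get the same for `a_s^* m_lam`, where
`𝔟_μ^*` occurs. If `lam` is permissible, then the first nonpermissible point `μ` of `s` has a lower
level, and the invariance of the ideal at that level, known by induction, suffices; if `lam` is not
permissible, then neither is `t`, and `m_lam a_t` is already in the ideal. So all
`m̃^lam_{st}` with `s` or `t` nonpermissible lie in `ker φ_r`. Their number is the dimension of
`ker φ_r`, so they span it (`QuotientTower.exists_basis_ker_φ`), and `ker φ_r` is invariant because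
`(m̃^lam_{st})^* = m̃^lam_{ts}`. Expanding elements of `ker φ_r ∩ A_r^S` in the basis
`m̂^lam_{st}` then shows that this kernel is the ideal generated by the elements `𝔟_μ`, which
completes the induction (`QuotientTower.starStable`).
-/

/-! ### Bilinear combinations -/

/-- The bilinear extension of a doubly indexed family `f s t` to finitely supported coordinate
vectors. -/
noncomputable def bilinComb (R : Type*) [CommSemiring R] {M : Type*} [AddCommMonoid M] [Module R M]
    {ι κ : Type*} (f : ι → κ → M) : (ι →₀ R) →ₗ[R] (κ →₀ R) →ₗ[R] M :=
  Finsupp.linearCombination R (fun s => Finsupp.linearCombination R (f s))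

section bilinComb
variable {R : Type*} [CommSemiring R] {M : Type*} [AddCommMonoid M] [Module R M] {ι κ : Type*}

theorem bilinComb_apply (f : ι → κ → M) (x : ι →₀ R) (y : κ →₀ R) :
    bilinComb R f x y = x.sum fun s p => y.sum fun t q => (p * q) • f s t := by
  simp only [bilinComb, Finsupp.linearCombination_apply, Finsupp.sum, LinearMap.sum_apply,
    LinearMap.smul_apply, Finset.smul_sum, mul_smul]

@[simp]
theorem bilinComb_single (f : ι → κ → M) (s : ι) (p : R) (y : κ →₀ R) :
    bilinComb R f (Finsupp.single s p) y = p • Finsupp.linearCombination R (f s) y := by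
  simp [bilinComb]

theorem bilinComb_single_single (f : ι → κ → M) (s : ι) (t : κ) :
    bilinComb R f (Finsupp.single s 1) (Finsupp.single t 1) = f s t := by
  simp

theorem map_bilinComb {N : Type*} [AddCommMonoid N] [Module R N] (g : M →ₗ[R] N)
    (f : ι → κ → M) (x : ι →₀ R) (y : κ →₀ R) :
    g (bilinComb R f x y) = bilinComb R (fun s t => g (f s t)) x y := by
  simp [bilinComb_apply, Finsupp.sum]

theorem bilinComb_mem (N : Submodule R M) {f : ι → κ → M} (h : ∀ s t, f s t ∈ N) (x : ι →₀ R)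
    (y : κ →₀ R) : bilinComb R f x y ∈ N := by
  rw [bilinComb_apply]
  exact N.sum_mem fun s _ => N.sum_mem fun t _ => N.smul_mem _ (h s t)

end bilinComb

/-- A bilinear comparison of two families modulo a submodule can be checked on the members. -/
theorem bilinComb_sub_mem {R : Type*} [CommRing R] {M : Type*} [AddCommGroup M] [Module R M]
    {ι κ : Type*} (N : Submodule R M) {f g : ι → κ → M} (h : ∀ s t, f s t - g s t ∈ N)
    (x : ι →₀ R) (y : κ →₀ R) : bilinComb R f x y - bilinComb R g x y ∈ N := by
  simp only [bilinComb_apply, Finsupp.sum, ← Finset.sum_sub_distrib, ← smul_sub]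
  exact N.sum_mem fun s _ => N.sum_mem fun t _ => N.smul_mem _ (h s t)

/-- Bilinear combinations are compatible with extension of scalars along a linear map. -/
theorem bilinComb_mapRange {R E : Type*} [CommRing R] [CommRing E] [Algebra R E]
    {M N ι κ : Type*} [AddCommGroup M] [Module R M] [AddCommGroup N] [Module R N] [Module E N]
    [IsScalarTower R E N] (g : M →ₗ[R] N) (f : ι → κ → M) (x : ι →₀ R) (y : κ →₀ R) :
    bilinComb E (fun s t => g (f s t)) (x.mapRange (algebraMap R E) (map_zero _))
      (y.mapRange (algebraMap R E) (map_zero _)) = g (bilinComb R f x y) := by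
  induction x using Finsupp.induction_linear with
  | zero => simp
  | add x x' hx hx' =>
    rw [Finsupp.mapRange_add (map_add _), map_add, LinearMap.add_apply, hx, hx', map_add,
      LinearMap.add_apply, map_add]
  | single s p =>
    induction y using Finsupp.induction_linear with
    | zero => simp
    | add y y' hy hy' =>
      rw [Finsupp.mapRange_add (map_add _), map_add, hy, hy', map_add, map_add]
    | single t q => simp

/-! ### Cell data -/

namespace CellDatum

variable {R : Type*} [CommRing R] {A : Type*} [Ring A] [Algebra R A]
  {Λ : Type*} [PartialOrder Λ] [Finite Λ] {T : Λ → Type*} [∀ lam, Finite (T lam)]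
  (D : CellDatum R A Λ T)

/-- The span of the cell basis elements whose label lies in `U`; it is a two-sided ideal if `U` is
an upper set. -/
def cellSpan (U : Set Λ) : Submodule R A := Submodule.span R (D.basis '' {i | i.1 ∈ U})

variable {D}

theorem mem_cellSpan {U : Set Λ} {x : A} :
    x ∈ D.cellSpan U ↔ ∀ i, i.1 ∉ U → D.basis.repr x i = 0 := by
  rw [cellSpan, Module.Basis.mem_span_image]
  constructor
  · intro h i hi
    by_contra h0
    exact hi (h (Finsupp.mem_support_iff.2 h0))
  · intro h i hi
    by_contra h0
    exact Finsupp.mem_support_iff.1 hi (h i h0)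

theorem cellSpan_mono {U V : Set Λ} (h : U ⊆ V) : D.cellSpan U ≤ D.cellSpan V :=
  Submodule.span_mono (Set.image_mono fun _ hi => h hi)

theorem c_mem_cellSpan {U : Set Λ} {lam : Λ} (h : lam ∈ U) (s t : T lam) :
    D.c lam s t ∈ D.cellSpan U :=
  Submodule.subset_span ⟨⟨lam, s, t⟩, h, rfl⟩

variable (D)

theorem above_eq (lam : Λ) : D.above lam = D.cellSpan (Set.Ioi lam) := by
  rw [above, cellSpan]
  congr 1
  ext x
  constructor
  · rintro ⟨μ, h, p, q, rfl⟩
    exact ⟨⟨μ, p, q⟩, h, rfl⟩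
  · rintro ⟨⟨μ, p, q⟩, h, rfl⟩
    exact ⟨μ, h, p, q, rfl⟩

theorem mem_above {lam : Λ} {x : A} :
    x ∈ D.above lam ↔ ∀ i, ¬ lam < i.1 → D.basis.repr x i = 0 := by
  rw [above_eq, mem_cellSpan]; rfl

theorem c_mul_sub_mem (lam : Λ) (a : A) (s t : T lam) :
    D.c lam s t * a - Finsupp.linearCombination R (D.c lam s) (D.coef lam a t) ∈ D.above lam :=
  D.mul_coef lam a s t

theorem star_c_sub_mem (lam : Λ) (s t : T lam) :
    D.star (D.c lam s t) - D.c lam t s ∈ D.above lam :=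
  D.star_basis lam s t

theorem above_le_cellSpan {U : Set Λ} (hU : IsUpperSet U) {lam : Λ} (h : lam ∈ U) :
    D.above lam ≤ D.cellSpan U := by
  rw [above_eq]
  exact cellSpan_mono fun μ hμ => hU (le_of_lt hμ) h

variable {D} in
theorem mul_mem_cellSpan_left {U : Set Λ} (hU : IsUpperSet U) {x : A} (hx : x ∈ D.cellSpan U)
    (a : A) : x * a ∈ D.cellSpan U := by
  refine Submodule.span_induction (p := fun x _ => x * a ∈ D.cellSpan U) ?_ ?_ ?_ ?_ hx
  · rintro _ ⟨⟨lam, s, t⟩, h, rfl⟩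
    replace h : lam ∈ U := h
    rw [← sub_add_cancel (D.basis ⟨lam, s, t⟩ * a)
      (Finsupp.linearCombination R (D.c lam s) (D.coef lam a t))]
    refine add_mem (D.above_le_cellSpan hU (lam := lam) h (D.mul_coef lam a s t)) ?_
    rw [Finsupp.linearCombination_apply]
    exact Submodule.sum_mem _ fun v _ => Submodule.smul_mem _ _ (c_mem_cellSpan h s v)
  · simp
  · intro x y _ _ hx hy
    rw [add_mul]; exact add_mem hx hy
  · intro r x _ hx
    rw [smul_mul_assoc]; exact Submodule.smul_mem _ _ hx

variable {D} in
theorem star_mem_cellSpan {U : Set Λ} (hU : IsUpperSet U) {x : A} (hx : x ∈ D.cellSpan U) :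
    D.star x ∈ D.cellSpan U := by
  refine Submodule.span_induction (p := fun x _ => D.star x ∈ D.cellSpan U) ?_ ?_ ?_ ?_ hx
  · rintro _ ⟨⟨lam, s, t⟩, h, rfl⟩
    replace h : lam ∈ U := h
    rw [← sub_add_cancel (D.star (D.basis ⟨lam, s, t⟩)) (D.c lam t s)]
    exact add_mem (D.above_le_cellSpan hU (lam := lam) h (D.star_basis lam s t)) (c_mem_cellSpan h t s)
  · simp
  · intro x y _ _ hx hy
    rw [map_add]; exact add_mem hx hy
  · intro r x _ hx
    rw [map_smul]; exact Submodule.smul_mem _ _ hx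

variable {D} in
theorem mul_mem_cellSpan_right {U : Set Λ} (hU : IsUpperSet U) {x : A} (hx : x ∈ D.cellSpan U)
    (a : A) : a * x ∈ D.cellSpan U := by
  rw [← D.star_star (a * x), D.star_mul]
  exact star_mem_cellSpan hU (mul_mem_cellSpan_left hU (star_mem_cellSpan hU hx) _)

variable {D}

theorem above_mul_mem {lam : Λ} {x : A} (hx : x ∈ D.above lam) (a : A) : x * a ∈ D.above lam := by
  rw [above_eq] at *
  exact mul_mem_cellSpan_left (isUpperSet_Ioi lam) hx a

theorem mul_above_mem {lam : Λ} {x : A} (hx : x ∈ D.above lam) (a : A) : a * x ∈ D.above lam := by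
  rw [above_eq] at *
  exact mul_mem_cellSpan_right (isUpperSet_Ioi lam) hx a

theorem star_mem_above {lam : Λ} {x : A} (hx : x ∈ D.above lam) : D.star x ∈ D.above lam := by
  rw [above_eq] at *
  exact star_mem_cellSpan (isUpperSet_Ioi lam) hx

variable (D)

theorem repr_linearCombination_c (lam : Λ) (s : T lam) (x : T lam →₀ R) (v : T lam) :
    D.basis.repr (Finsupp.linearCombination R (D.c lam s) x) ⟨lam, s, v⟩ = x v := by
  classical
  rw [Finsupp.linearCombination_apply, Finsupp.sum, map_sum, Finsupp.finsetSum_apply]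
  simp only [map_smul, c, Module.Basis.repr_self, Finsupp.smul_apply, smul_eq_mul]
  rw [Finset.sum_eq_single v]
  · simp
  · intro b _ hb
    rw [Finsupp.single_apply, if_neg, mul_zero]
    simpa using hb
  · intro h
    simpa using h

/-- The coefficients `r(a; t, v)` can be read off from the products `c^lam_{st} a`. -/
theorem coef_apply (lam : Λ) (a : A) (s t v : T lam) :
    D.coef lam a t v = D.basis.repr (D.c lam s t * a) ⟨lam, s, v⟩ := by
  have h := D.mem_above.1 (D.c_mul_sub_mem lam a s t) ⟨lam, s, v⟩ (lt_irrefl lam)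
  rw [map_sub, Finsupp.sub_apply, repr_linearCombination_c, sub_eq_zero] at h
  exact h.symm

/-- The action of `A` on a cell module, as a linear map in the algebra element. -/
noncomputable def actHom (lam : Λ) : A →ₗ[R] Module.End R (T lam →₀ R) where
  toFun := D.act lam
  map_add' a b := by
    ext t v
    simp [act, D.coef_apply lam _ t t v, mul_add]
  map_smul' r a := by
    ext t v
    simp [act, D.coef_apply lam _ t t v]

@[simp]
theorem actHom_apply (lam : Λ) (a : A) : D.actHom lam a = D.act lam a := rfl

theorem lift_eq (lam : Λ) (x y : T lam →₀ R) : D.lift lam x y = bilinComb R (D.c lam) x y :=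
  (bilinComb_apply _ _ _).symm

theorem lift_mul_sub_mem (lam : Λ) (x y : T lam →₀ R) (a : A) :
    D.lift lam x y * a - D.lift lam x (D.act lam a y) ∈ D.above lam := by
  have h1 : D.lift lam x y * a = bilinComb R (fun s t => D.c lam s t * a) x y := by
    rw [lift_eq]
    exact map_bilinComb (LinearMap.mulRight R a) _ x y
  have h2 : D.lift lam x (D.act lam a y) =
      bilinComb R (fun s t => Finsupp.linearCombination R (D.c lam s) (D.coef lam a t)) x y := by
    rw [lift_eq]
    suffices (bilinComb R (D.c lam)).compl₂ (D.act lam a) =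
      bilinComb R (fun s t => Finsupp.linearCombination R (D.c lam s) (D.coef lam a t)) from
      LinearMap.congr_fun₂ this x y
    ext s t
    simp [act]
  rw [h1, h2]
  exact bilinComb_sub_mem _ (fun s t => D.c_mul_sub_mem lam a s t) x y

theorem star_lift_sub_mem (lam : Λ) (x y : T lam →₀ R) :
    D.star (D.lift lam x y) - D.lift lam y x ∈ D.above lam := by
  have h2 : D.lift lam y x = bilinComb R (fun s t => D.c lam t s) x y := by
    rw [lift_eq]
    suffices (bilinComb R (D.c lam)).flip = bilinComb R (fun s t => D.c lam t s) from
      LinearMap.congr_fun₂ this x y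
    ext s t
    simp
  rw [h2, lift_eq, map_bilinComb]
  exact bilinComb_sub_mem _ (fun s t => D.star_c_sub_mem lam s t) x y

theorem star_mul_lift_sub_mem (lam : Λ) (x y : T lam →₀ R) (a : A) :
    D.star a * D.lift lam x y - D.lift lam (D.act lam a x) y ∈ D.above lam := by
  have h1 := star_mem_above (D.lift_mul_sub_mem lam y x a)
  have h2 := mul_above_mem (D.star_lift_sub_mem lam y x) (D.star a)
  have h3 := D.star_lift_sub_mem lam y (D.act lam a x)
  rw [map_sub, D.star_mul] at h1
  rw [mul_sub] at h2
  have := add_mem (sub_mem h1 h2) h3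
  convert this using 1
  abel

theorem act_mul (lam : Λ) (a b : A) : D.act lam (a * b) = D.act lam b ∘ₗ D.act lam a := by
  ext t v
  have h : Finsupp.linearCombination R (D.c lam t) (D.act lam b (D.coef lam a t))
      - D.c lam t t * (a * b) ∈ D.above lam := by
    have h1 := above_mul_mem (D.c_mul_sub_mem lam a t t) b
    have h2 := D.lift_mul_sub_mem lam (Finsupp.single t 1) (D.coef lam a t) b
    simp only [lift_eq, bilinComb_single, one_smul] at h2
    rw [sub_mul, mul_assoc] at h1
    convert neg_mem (add_mem h1 h2) using 1
    abel
  have h := D.mem_above.1 h ⟨lam, t, v⟩ (lt_irrefl lam)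
  rw [map_sub, Finsupp.sub_apply, repr_linearCombination_c, ← coef_apply, sub_eq_zero] at h
  simpa [act] using h.symm

theorem act_one (lam : Λ) : D.act lam 1 = LinearMap.id := by
  classical
  ext t v
  simp [act, D.coef_apply lam 1 t t v, c, Finsupp.single_apply]

end CellDatum

/-! ### Separating elements of cell modules -/

/-- In a semisimple ring every left ideal has a right identity. -/
theorem Submodule.exists_right_identity {B : Type*} [Ring B] [IsSemisimpleRing B]
    (J : Submodule B B) : ∃ e ∈ J, ∀ x ∈ J, x * e = x := by
  obtain ⟨J', h⟩ := ComplementedLattice.exists_isCompl J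
  obtain ⟨e, he, f, hf, hef⟩ := Submodule.mem_sup.1
    (show (1 : B) ∈ J ⊔ J' by rw [h.sup_eq_top]; trivial)
  refine ⟨e, he, fun x hx => ?_⟩
  have h1 : x * f ∈ J' := J'.smul_mem x hf
  have h2 : x * f = x - x * e := by
    rw [eq_sub_iff_add_eq', ← mul_add, hef, mul_one]
  have h3 : x * f ∈ J := by
    rw [h2]; exact J.sub_mem hx (J.smul_mem x he)
  have h4 : x * f = 0 := Submodule.disjoint_def.1 h.disjoint _ h3 h1
  rw [h4] at h2
  exact (sub_eq_zero.1 h2.symm).symm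

theorem IsSplitSemisimple.isSemisimpleRing {F : Type*} [Field F] {B : Type*} [Ring B]
    [Algebra F B] (h : IsSplitSemisimple F B) : IsSemisimpleRing B := by
  obtain ⟨n, d, hd, ⟨e⟩⟩ := h
  exact e.symm.toRingEquiv.isSemisimpleRing

/-- If the scalar extension of a free algebra to the fraction field is semisimple, then every left
ideal contains an element that acts on it from the right as a nonzero scalar. -/
theorem exists_mul_eq_smul_of_isSemisimpleRing {R A : Type*} [CommRing R] [IsDomain R] [Ring A]
    [Algebra R A] [Module.Free R A] [IsSemisimpleRing (FractionRing R ⊗[R] A)]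
    (J : Submodule R A) (hJ : ∀ a, ∀ x ∈ J, a * x ∈ J) :
    ∃ r : R, r ≠ 0 ∧ ∃ e ∈ J, ∀ x ∈ J, x * e = r • x := by
  set F := FractionRing R
  have hsurj : ∀ z : F ⊗[R] A, ∃ r : R, r ≠ 0 ∧ ∃ a : A, r • z = 1 ⊗ₜ[R] a := by
    intro z
    obtain ⟨⟨a, r⟩, h⟩ := IsLocalizedModule.surj (nonZeroDivisors R) (TensorProduct.mk R F A 1) z
    exact ⟨r, nonZeroDivisors.ne_zero r.2, a, h⟩
  have hinj : ∀ a b : A, (1 : F) ⊗ₜ[R] a = 1 ⊗ₜ[R] b → a = b := fun a b h =>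
    Algebra.TensorProduct.includeRight_injective (R := R) (A := F) (B := A)
      (IsFractionRing.injective R F) h
  -- the left ideal of the fractions `a / r` with `a` in `J`
  let J' : Submodule (F ⊗[R] A) (F ⊗[R] A) :=
    { carrier := {z | ∃ r : R, r ≠ 0 ∧ ∃ a ∈ J, r • z = 1 ⊗ₜ[R] a}
      zero_mem' := ⟨1, one_ne_zero, 0, J.zero_mem, by simp⟩
      add_mem' := by
        rintro x y ⟨r, hr, a, ha, h⟩ ⟨r', hr', a', ha', h'⟩
        refine ⟨r * r', mul_ne_zero hr hr', r' • a + r • a',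
          J.add_mem (J.smul_mem _ ha) (J.smul_mem _ ha'), ?_⟩
        rw [smul_add, mul_comm r r', mul_smul, h, mul_comm r' r, mul_smul, h',
          TensorProduct.tmul_add, TensorProduct.tmul_smul, TensorProduct.tmul_smul]
      smul_mem' := by
        rintro c x ⟨r, hr, a, ha, h⟩
        obtain ⟨r', hr', a', h'⟩ := hsurj c
        refine ⟨r' * r, mul_ne_zero hr' hr, a' * a, hJ _ _ ha, ?_⟩
        rw [smul_eq_mul, ← smul_mul_smul_comm, h, h', Algebra.TensorProduct.tmul_mul_tmul, one_mul] }
  obtain ⟨e, ⟨r, hr, a, ha, h⟩, he⟩ := J'.exists_right_identity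
  refine ⟨r, hr, a, ha, fun x hx => hinj _ _ ?_⟩
  have hx' := he (1 ⊗ₜ[R] x) ⟨1, one_ne_zero, x, hx, by simp⟩
  rw [TensorProduct.tmul_smul, ← hx', ← mul_smul_comm, h, Algebra.TensorProduct.tmul_mul_tmul, one_mul]

namespace CellDatum

variable {R : Type*} [CommRing R] {A : Type*} [Ring A] [Algebra R A]
  {Λ : Type*} [PartialOrder Λ] [Finite Λ] {T : Λ → Type*} [∀ lam, Finite (T lam)]
  (D : CellDatum R A Λ T)

/-- For every upper set `U` of labels there is an element that acts as a nonzero scalar on the cell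
modules with label in `U`, and as zero on all others. -/
theorem exists_separating [IsDomain R] (hss : IsSemisimpleRing (FractionRing R ⊗[R] A))
    {U : Set Λ} (hU : IsUpperSet U) :
    ∃ r : R, r ≠ 0 ∧ ∃ e : A, e * e = r • e ∧ (∀ lam ∈ U, D.act lam e = r • LinearMap.id) ∧
      ∀ lam ∉ U, D.act lam e = 0 := by
  classical
  have : Module.Free R A := Module.Free.of_basis D.basis
  obtain ⟨r, hr, e, he, h⟩ := exists_mul_eq_smul_of_isSemisimpleRing (D.cellSpan U)
    (fun a x hx => mul_mem_cellSpan_right hU hx a)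
  refine ⟨r, hr, e, h e he, fun lam hlam => ?_, fun lam hlam => ?_⟩
  · ext t v
    have := D.coef_apply lam e t t v
    rw [h _ (c_mem_cellSpan hlam t t)] at this
    simp [act, this, c, Finsupp.single_apply]
  · ext t v
    have := mem_cellSpan.1 (mul_mem_cellSpan_right hU he (D.c lam t t)) ⟨lam, t, v⟩ hlam
    simp [act, D.coef_apply lam e t t v, this]

end CellDatum

namespace CellTower

variable {R : Type*} [CommRing R] {A : ℕ → Type*} [∀ r, Ring (A r)]
  [∀ r, Algebra R (A r)] {Λ : ℕ → Type*} [∀ r, PartialOrder (Λ r)] [∀ r, Finite (Λ r)]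
  {T : ∀ r, Λ r → Type*} [∀ r lam, Finite (T r lam)] {C : CellTower R A Λ T}

namespace CellFiltration

variable {r : ℕ} {μ : Λ (r + 1)} (M : C.CellFiltration r μ)

theorem label_strictAnti : StrictAnti M.label := M.label_anti

theorem exists_threshold {U : Set (Λ r)} (hU : IsUpperSet U) :
    ∃ j : Fin (M.n + 1), ∀ i : Fin M.n, M.label i ∈ U ↔ i.castSucc < j := by
  by_cases h : ∃ i : Fin M.n, M.label i ∉ U
  · obtain ⟨i, hi, hmin⟩ := WellFounded.has_min (wellFounded_lt (α := Fin M.n))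
      {i | M.label i ∉ U} h
    refine ⟨i.castSucc, fun k => ?_⟩
    rw [Fin.castSucc_lt_castSucc_iff]
    constructor
    · intro hk
      by_contra hlt
      exact hi (hU (M.label_strictAnti.antitone (not_lt.1 hlt)) hk)
    · intro hk
      by_contra hkU
      exact hmin k hkU hk
  · push Not at h
    exact ⟨Fin.last _, fun i => ⟨fun _ => Fin.castSucc_lt_last i, fun _ => h i⟩⟩

theorem quo_eq_of_act (i : Fin M.n) (a : A r) (x : T (r + 1) μ →₀ R) (hx : x ∈ M.sub i.succ)
    (h : (C.datum (r + 1)).act μ (C.incl r a) x ∈ M.sub i.succ) :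
    M.quo i ⟨_, h⟩ = (C.datum r).act (M.label i) a (M.quo i ⟨x, hx⟩) :=
  M.quo_act i a ⟨x, hx⟩

theorem sub_mem_of_quo_eq {i : Fin M.n} {x y : M.sub i.succ} (h : M.quo i x = M.quo i y) :
    x.1 - y.1 ∈ M.sub i.castSucc := by
  have h1 : x = ⟨x.1 - y.1, sub_mem x.2 y.2⟩ + y := Subtype.ext (sub_add_cancel x.1 y.1).symm
  have h2 := congrArg (M.quo i) h1
  rw [map_add, h, right_eq_add] at h2
  exact (M.quo_eq_zero i _).1 h2

/-- The steps of a cell filtration are eigenspaces of separating elements, so they do not depend on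
the filtration. -/
theorem mem_sub_iff [IsDomain R] {U : Set (Λ r)} {j : Fin (M.n + 1)}
    (hj : ∀ i : Fin M.n, M.label i ∈ U ↔ i.castSucc < j) {ρ : R} (hρ : ρ ≠ 0) {e : A r}
    (hee : e * e = ρ • e)
    (he : ∀ lam ∈ U, (C.datum r).act lam e = ρ • LinearMap.id)
    (he0 : ∀ lam ∉ U, (C.datum r).act lam e = 0) (x : T (r + 1) μ →₀ R) :
    x ∈ M.sub j ↔ (C.datum (r + 1)).act μ (C.incl r e) x = ρ • x := by
  set E := (C.datum (r + 1)).act μ (C.incl r e) with hE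
  have hEE : ∀ z, E (E z) = ρ • E z := by
    intro z
    have h1 := (C.datum (r + 1)).act_mul μ (C.incl r e) (C.incl r e)
    rw [← map_mul, hee, map_smul, ← CellDatum.actHom_apply, map_smul] at h1
    exact (LinearMap.congr_fun h1 z).symm
  constructor
  -- on the step `j`, the element `E x - ρ x` is killed by `E`, which acts as `ρ` on every
  -- subquotient below `j`
  · intro hx
    suffices h : ∀ k : Fin (M.n + 1), k ≤ j → ∀ y ∈ M.sub k, E y = 0 → y = 0 by
      refine sub_eq_zero.1 (h j le_rfl _
        (sub_mem (M.sub_act _ e _ hx) (Submodule.smul_mem _ _ hx)) ?_)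
      rw [map_sub, map_smul, hEE, sub_self]
    intro k
    induction k using Fin.induction with
    | zero => intro _ y hy _; simpa [M.sub_zero] using hy
    | succ i ih =>
      intro hi y hy hy0
      have hi' : i.castSucc < j := lt_of_lt_of_le i.castSucc_lt_succ hi
      refine ih hi'.le y ((M.quo_eq_zero i ⟨y, hy⟩).1 ?_) hy0
      have h1 := M.quo_eq_of_act i e y hy (M.sub_act _ e _ hy)
      rw [he _ ((hj i).2 hi')] at h1
      have h2 : M.quo i ⟨_, M.sub_act _ e _ hy⟩ = 0 := by
        rw [M.quo_eq_zero]
        change E y ∈ _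
        rw [hy0]
        exact zero_mem _
      rw [h2] at h1
      exact (smul_eq_zero.1 h1.symm).resolve_left hρ
  -- above the step `j`, the element `E` acts as zero on the subquotients, so a vector on which it
  -- acts as `ρ` descends to the step `j`
  · intro hx
    suffices h : ∀ k : Fin (M.n + 1), j ≤ k → x ∈ M.sub k → x ∈ M.sub j from
      h (Fin.last _) (Fin.le_last _) (by rw [M.sub_last]; trivial)
    intro k
    induction k using Fin.induction with
    | zero =>
      intro h0 hx0
      rwa [le_antisymm h0 (Fin.zero_le _)]
    | succ i ih =>
      intro hi hxi
      rcases hi.eq_or_lt with rfl | hlt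
      · exact hxi
      have hji : j ≤ i.castSucc := Fin.le_castSucc_iff.2 hlt
      refine ih hji ((M.quo_eq_zero i ⟨x, hxi⟩).1 ?_)
      have h1 := M.quo_eq_of_act i e x hxi (M.sub_act _ e _ hxi)
      rw [he0 _ (fun h => absurd ((hj i).1 h) (not_lt.2 hji))] at h1
      have h2 : (⟨_, M.sub_act _ e _ hxi⟩ : M.sub i.succ) = ρ • ⟨x, hxi⟩ := Subtype.ext hx
      rw [h2, map_smul] at h1
      exact (smul_eq_zero.1 h1).resolve_left hρ

theorem sub_eq_sub [IsDomain R] (hss : IsSemisimpleRing (FractionRing R ⊗[R] A r))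
    (M M' : C.CellFiltration r μ) {U : Set (Λ r)} (hU : IsUpperSet U)
    {j : Fin (M.n + 1)} {j' : Fin (M'.n + 1)}
    (hj : ∀ i : Fin M.n, M.label i ∈ U ↔ i.castSucc < j)
    (hj' : ∀ i : Fin M'.n, M'.label i ∈ U ↔ i.castSucc < j') : M.sub j = M'.sub j' := by
  obtain ⟨ρ, hρ, e, hee, he, he0⟩ := (C.datum r).exists_separating hss hU
  ext x
  rw [M.mem_sub_iff hj hρ hee he he0, M'.mem_sub_iff hj' hρ hee he he0]

theorem label_mem_Ici (i k : Fin M.n) :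
    M.label k ∈ Set.Ici (M.label i) ↔ k.castSucc < i.succ := by
  rw [Set.mem_Ici, M.label_strictAnti.le_iff_ge, Fin.castSucc_lt_succ_iff]

theorem label_mem_Ioi (i k : Fin M.n) :
    M.label k ∈ Set.Ioi (M.label i) ↔ k.castSucc < i.castSucc := by
  rw [Set.mem_Ioi, M.label_strictAnti.lt_iff_gt, Fin.castSucc_lt_castSucc_iff]

theorem sub_castSucc_ne_sub_succ [Nontrivial R] (i : Fin M.n) (hne : Nonempty (T r (M.label i))) :
    M.sub i.castSucc ≠ M.sub i.succ := by
  intro h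
  obtain ⟨t⟩ := hne
  obtain ⟨x, hx⟩ := M.quo_surjective i (Finsupp.single t 1)
  have h0 : M.quo i x = 0 := (M.quo_eq_zero i x).2 (by rw [h]; exact x.2)
  rw [h0] at hx
  simpa using (DFunLike.congr_fun hx t)

/-- All cell filtrations of a restricted cell module have the same labels. -/
theorem exists_label_eq [IsDomain R] (hss : IsSemisimpleRing (FractionRing R ⊗[R] A r))
    (M M' : C.CellFiltration r μ) (i : Fin M.n)
    (hne : Nonempty (T r (M.label i))) : ∃ i', M'.label i' = M.label i := by
  by_contra! h
  obtain ⟨j, hj⟩ := M'.exists_threshold (isUpperSet_Ici (M.label i))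
  refine M.sub_castSucc_ne_sub_succ i hne ?_
  rw [sub_eq_sub hss M M' (isUpperSet_Ici (M.label i)) (M.label_mem_Ici i) hj,
    sub_eq_sub hss M M' (isUpperSet_Ioi (M.label i)) (j' := j) (M.label_mem_Ioi i)]
  intro k
  rw [← hj k, Set.mem_Ioi, Set.mem_Ici]
  exact ⟨le_of_lt, fun hk => lt_of_le_of_ne hk (h k).symm⟩

end CellFiltration
end CellTower

/-! ### The path basis of a cell module -/

section filtration

variable {R V : Type*} [CommRing R] [AddCommGroup V] [Module R V] {n : ℕ}
  {sub : Fin (n + 1) → Submodule R V} {N : Fin n → Type*} [∀ i, AddCommGroup (N i)]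
  [∀ i, Module R (N i)] {q : ∀ i, sub i.succ →ₗ[R] N i} {ι : Fin n → Type*}
  {v : ∀ i, ι i → sub i.succ}

/-- Lifts of spanning families of the subquotients of a filtration span its steps. -/
theorem le_span_of_filtration (h0 : sub 0 = ⊥)
    (hker : ∀ i x, q i x = 0 ↔ x.1 ∈ sub i.castSucc)
    (hspan : ∀ i, Submodule.span R (Set.range fun t => q i (v i t)) = ⊤) (j : Fin (n + 1)) :
    sub j ≤ Submodule.span R {x | ∃ i : Fin n, i.castSucc < j ∧ ∃ t, x = (v i t : V)} := by
  induction j using Fin.induction with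
  | zero => rw [h0]; exact bot_le
  | succ i ih =>
    intro x hx
    have h1 : q i ⟨x, hx⟩ ∈ Submodule.span R (Set.range fun t => q i (v i t)) := by
      rw [hspan]; trivial
    obtain ⟨c, hc⟩ := Finsupp.mem_span_range_iff_exists_finsupp.1 h1
    set y : sub i.succ := c.sum fun t a => a • v i t with hy
    have h2 : q i (⟨x, hx⟩ - y) = 0 := by
      rw [map_sub, sub_eq_zero, ← hc, hy]
      simp only [Finsupp.sum, map_sum, map_smul]
    have h3 := ih ((hker i _).1 h2)
    have h4 : (y : V) ∈
        Submodule.span R {x | ∃ k : Fin n, k.castSucc < i.succ ∧ ∃ t, x = (v k t : V)} := by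
      rw [hy, Finsupp.sum, AddSubmonoidClass.coe_finsetSum]
      exact Submodule.sum_mem _ fun t _ => Submodule.smul_mem _ _
        (Submodule.subset_span ⟨i, i.castSucc_lt_succ, t, rfl⟩)
    have h5 := add_mem (Submodule.span_mono (by
      rintro _ ⟨k, hk, t, rfl⟩
      exact ⟨k, hk.trans i.castSucc_lt_succ, t, rfl⟩) h3) h4
    simpa using h5

/-- Lifts of linearly independent families in the subquotients of a filtration are together
linearly independent. -/
theorem linearIndependent_of_filtration (hle : ∀ i : Fin n, sub i.castSucc ≤ sub i.succ)
    (hker : ∀ i x, q i x = 0 ↔ x.1 ∈ sub i.castSucc)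
    (hli : ∀ i, LinearIndependent R fun t => q i (v i t)) :
    LinearIndependent R fun p : Σ i, ι i => (v p.1 p.2 : V) := by
  classical
  have hmono : Monotone sub := Fin.monotone_iff_le_succ.2 hle
  rw [linearIndependent_iff]
  intro l hl
  have hsum : ∑ i, Finsupp.linearCombination R (fun t => (v i t : V)) (l.split i) = 0 := by
    rw [← hl, Finsupp.linearCombination_apply, Finsupp.sigma_sum]
    symm
    refine Finset.sum_subset (Finset.subset_univ _) fun i _ hi => ?_
    have : l.split i = 0 := by
      by_contra h
      exact hi ((Finsupp.mem_splitSupport_iff_nonzero l i).2 h)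
    rw [this, Finsupp.sum_zero_index]
  have hcoe : ∀ (i : Fin n) (c : ι i →₀ R), Finsupp.linearCombination R (fun t => (v i t : V)) c =
      (Finsupp.linearCombination R (v i) c : sub i.succ) := fun i c => by
    simp [Finsupp.linearCombination_apply, Finsupp.sum]
  have hzero : ∀ k : Fin n, l.split k = 0 := by
    intro k
    induction k using WellFoundedGT.induction with
    | ind k ih =>
    rw [← Finset.add_sum_erase _ _ (Finset.mem_univ k)] at hsum
    have hmem : Finsupp.linearCombination R (fun t => (v k t : V)) (l.split k) ∈
        sub k.castSucc := by
      rw [eq_neg_of_add_eq_zero_left hsum]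
      refine neg_mem (Submodule.sum_mem _ fun i hi => ?_)
      rcases lt_or_gt_of_ne (Finset.ne_of_mem_erase hi) with h | h
      · rw [hcoe]
        exact hmono (Fin.succ_le_castSucc_iff.2 h) (Subtype.property _)
      · rw [ih i h, map_zero]
        exact zero_mem _
    rw [hcoe, ← hker] at hmem
    have h2 := linearIndependent_iff.1 (hli k) (l.split k)
    refine h2 ?_
    rw [← hmem]
    simp [Finsupp.linearCombination_apply, Finsupp.sum]
  ext ⟨i, t⟩
  exact DFunLike.congr_fun (hzero i) t

end filtration

namespace DiagramTower

variable {R : Type*} [CommRing R] [IsDomain R] {A : ℕ → Type*} [∀ r, Ring (A r)]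
  [∀ r, Algebra R (A r)] {Λ : ℕ → Type*} [∀ r, PartialOrder (Λ r)] [∀ r, Finite (Λ r)]
  {T : ∀ r, Λ r → Type*} [∀ r lam, Finite (T r lam)] (D : DiagramTower R A Λ T)

theorem isSemisimpleRing (D : DiagramTower R A Λ T) (r : ℕ) :
    IsSemisimpleRing (FractionRing R ⊗[R] A r) :=
  (D.split_semisimple r).isSemisimpleRing

/-- The quotient map at a step of the filtration, for a label and for submodules that are only
propositionally those of the filtration. -/
theorem exists_quo {r : ℕ} {μ : Λ (r + 1)} (M : D.CellFiltration r μ) (i : Fin M.n) {lam : Λ r}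
    (hlam : M.label i = lam) {N N' : Submodule R (T (r + 1) μ →₀ R)} (hN : M.sub i.succ = N)
    (hN' : M.sub i.castSucc = N')
    (hact : ∀ (a : A r) x, x ∈ N → (D.datum (r + 1)).act μ (D.incl r a) x ∈ N)
    (h : (D.datum (r + 1)).act μ (D.d r lam μ) (D.δ (r + 1) μ) ∈ M.sub i.succ)
    (hq : M.quo i ⟨_, h⟩ = D.δ r (M.label i)) :
    ∃ q : N →ₗ[R] (T r lam →₀ R), Function.Surjective q ∧ (∀ x, q x = 0 ↔ x.1 ∈ N') ∧
      (∀ (a : A r) (x : N), q ⟨_, hact a _ x.2⟩ = (D.datum r).act lam a (q x)) ∧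
      ∃ h : (D.datum (r + 1)).act μ (D.d r lam μ) (D.δ (r + 1) μ) ∈ N, q ⟨_, h⟩ = D.δ r lam := by
  subst hlam hN hN'
  exact ⟨M.quo i, M.quo_surjective i, M.quo_eq_zero i, M.quo_act i, h, hq⟩

/-- There is a cell filtration that carries all edges into `μ` as labels and is adapted to all
down-branching factors at once. -/
theorem exists_adapted (r : ℕ) (μ : Λ (r + 1)) :
    ∃ M : D.CellFiltration r μ, (∀ lam, D.Edge lam μ → ∃ i, M.label i = lam) ∧
      ∀ i, ∃ h : (D.datum (r + 1)).act μ (D.d r (M.label i) μ) (D.δ (r + 1) μ) ∈ M.sub i.succ,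
        M.quo i ⟨_, h⟩ = D.δ r (M.label i) := by
  obtain ⟨M⟩ := D.restriction_coherent r μ
  have hss := D.isSemisimpleRing r
  have key : ∀ i : Fin M.n, ∃ q : M.sub i.succ →ₗ[R] (T r (M.label i) →₀ R),
      Function.Surjective q ∧ (∀ x, q x = 0 ↔ x.1 ∈ M.sub i.castSucc) ∧
      (∀ (a : A r) (x : M.sub i.succ), q ⟨_, M.sub_act _ a _ x.2⟩ =
        (D.datum r).act (M.label i) a (q x)) ∧
      ∃ h : (D.datum (r + 1)).act μ (D.d r (M.label i) μ) (D.δ (r + 1) μ) ∈ M.sub i.succ,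
        q ⟨_, h⟩ = D.δ r (M.label i) := by
    intro i
    obtain ⟨M', i', hi', h, hq⟩ := D.d_spec r (M.label i) μ ⟨M, i, rfl⟩
    refine D.exists_quo M' i' hi' ?_ ?_ _ h hq
    · exact CellTower.CellFiltration.sub_eq_sub hss M' M (isUpperSet_Ici (M.label i))
        (hi' ▸ M'.label_mem_Ici i') (M.label_mem_Ici i)
    · exact CellTower.CellFiltration.sub_eq_sub hss M' M (isUpperSet_Ioi (M.label i))
        (hi' ▸ M'.label_mem_Ioi i') (M.label_mem_Ioi i)
  choose q hq1 hq2 hq3 hq4 using key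
  refine ⟨{ M with quo := q, quo_surjective := hq1, quo_eq_zero := hq2, quo_act := hq3 }, ?_, hq4⟩
  rintro lam ⟨M', i', rfl⟩
  exact CellTower.CellFiltration.exists_label_eq hss M' M i' (D.nonempty_index _ _)

/-- The vector `δ(lam) d_t` of the cell module `Δ(lam)`. -/
noncomputable def pathVec {r : ℕ} {lam : Λ r} (t : D.Path r lam) : T r lam →₀ R :=
  (D.datum r).act lam (D.dPath t) (D.δ r lam)

/-- The path vectors of level `r` form bases of the cell modules. -/
def PathBasisAt (r : ℕ) : Prop :=
  ∀ lam : Λ r, LinearIndependent R (fun t : D.Path r lam => D.pathVec t) ∧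
    Submodule.span R (Set.range fun t : D.Path r lam => D.pathVec t) = ⊤

theorem adapted_mem_sub {r : ℕ} {μ : Λ (r + 1)} (M : D.CellFiltration r μ)
    {i : Fin M.n}
    (h : (D.datum (r + 1)).act μ (D.d r (M.label i) μ) (D.δ (r + 1) μ) ∈ M.sub i.succ)
    (hq : M.quo i ⟨_, h⟩ = D.δ r (M.label i)) (a : A r) :
    ∃ h' : (D.datum (r + 1)).act μ (D.d r (M.label i) μ * D.incl r a) (D.δ (r + 1) μ) ∈
      M.sub i.succ, M.quo i ⟨_, h'⟩ = (D.datum r).act (M.label i) a (D.δ r (M.label i)) := by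
  have h1 := M.sub_act _ a _ h
  have h2 := M.quo_act i a ⟨_, h⟩
  rw [hq] at h2
  refine ⟨by rw [CellDatum.act_mul]; exact h1, ?_⟩
  rw [← h2]
  congr 1
  ext1
  change (D.datum (r + 1)).act μ (D.d r (M.label i) μ * D.incl r a) (D.δ (r + 1) μ) = _
  rw [CellDatum.act_mul]
  rfl

/-- The path vectors of level `r + 1` form bases of the cell modules if those of level `r` do.
Moreover, modulo the path vectors through points larger than `lam`, the coordinates of
`δ(μ) d_{lam → μ} a` are those of `δ(lam) a`. -/
theorem pathBasis_step {r : ℕ} (hr : D.PathBasisAt r) (μ : Λ (r + 1)) :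
    (LinearIndependent R (fun t : D.Path (r + 1) μ => D.pathVec t) ∧
      Submodule.span R (Set.range fun t : D.Path (r + 1) μ => D.pathVec t) = ⊤) ∧
    ∀ (lam : Λ r) (e : D.Edge lam μ) (a : A r) (c : D.Path r lam →₀ R),
      (D.datum r).act lam a (D.δ r lam) = Finsupp.linearCombination R (fun t => D.pathVec t) c →
      (D.datum (r + 1)).act μ (D.d r lam μ * D.incl r a) (D.δ (r + 1) μ) -
        Finsupp.linearCombination R (fun t => D.pathVec (.cons t e)) c ∈
      Submodule.span R {x | ∃ (lam' : Λ r) (v : D.Path r lam') (e' : D.Edge lam' μ),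
        lam < lam' ∧ x = D.pathVec (.cons v e')} := by
  obtain ⟨M, hM, had⟩ := D.exists_adapted r μ
  choose h hq using had
  have hcons : ∀ (i : Fin M.n) (t : D.Path r (M.label i)),
      ∃ h' : D.pathVec (.cons t ⟨M, i, rfl⟩) ∈ M.sub i.succ,
        M.quo i ⟨_, h'⟩ = D.pathVec t := fun i t => D.adapted_mem_sub M (h i) (hq i) (D.dPath t)
  choose h' hq' using hcons
  let v : ∀ i : Fin M.n, D.Path r (M.label i) → M.sub i.succ := fun i t => ⟨_, h' i t⟩
  have hv : ∀ i, (fun t => M.quo i (v i t)) = fun t => D.pathVec t := fun i => funext (hq' i)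
  have hli := linearIndependent_of_filtration (v := v) M.sub_le M.quo_eq_zero fun i => by
    rw [hv]; exact (hr _).1
  have hsp := le_span_of_filtration (v := v) M.sub_zero M.quo_eq_zero fun i => by
    rw [hv]; exact (hr _).2
  refine ⟨⟨?_, ?_⟩, ?_⟩
  -- every path into `μ` passes through one of the labels of the adapted filtration
  · have hsurj : ∀ t : D.Path (r + 1) μ, ∃ p : Σ i, D.Path r (M.label i),
        t = .cons p.2 ⟨M, p.1, rfl⟩ := by
      intro t
      cases t with
      | cons t e =>
        obtain ⟨i, rfl⟩ := hM _ e
        exact ⟨⟨i, t⟩, rfl⟩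
    choose g hg using hsurj
    have hginj : Function.Injective g := by
      intro t t' htt
      rw [hg t, hg t', htt]
    have hfun : (fun t : D.Path (r + 1) μ => D.pathVec t) =
        (fun p : Σ i, D.Path r (M.label i) => (v p.1 p.2 : T (r + 1) μ →₀ R)) ∘ g :=
      funext fun t => congrArg D.pathVec (hg t)
    rw [hfun]
    exact hli.comp g hginj
  · rw [eq_top_iff, ← M.sub_last]
    refine (hsp _).trans (Submodule.span_mono ?_)
    rintro _ ⟨i, _, t, rfl⟩
    exact ⟨.cons t ⟨M, i, rfl⟩, rfl⟩
  · intro lam e a c hc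
    obtain ⟨i, rfl⟩ := hM lam e
    obtain ⟨ha, hqa⟩ := D.adapted_mem_sub M (h i) (hq i) a
    have h1 : M.quo i ⟨_, ha⟩ = M.quo i (Finsupp.linearCombination R (v i) c) := by
      rw [hqa, hc, ← hv, Finsupp.apply_linearCombination]
      rfl
    have h2 := hsp _ (M.sub_mem_of_quo_eq h1)
    have h3 : ((Finsupp.linearCombination R (v i) c : M.sub i.succ) : T (r + 1) μ →₀ R) =
        Finsupp.linearCombination R (fun t => D.pathVec (.cons t e)) c := by
      simp [Finsupp.linearCombination_apply, Finsupp.sum, v]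
    rw [h3] at h2
    refine Submodule.span_mono ?_ h2
    rintro _ ⟨k, hk, t, rfl⟩
    exact ⟨_, t, ⟨M, k, rfl⟩, M.label_strictAnti (Fin.castSucc_lt_castSucc_iff.1 hk), rfl⟩

end DiagramTower

/-! ### Block triangular families -/

section blockTriangular

variable {R M : Type*} [CommRing R] [AddCommGroup M] [Module R M]

/-- If each member of `b` lies, modulo members of `b` with larger label, in the span of the members
of `z` with the same label, then the members of `z` with labels in an upper set span at least
what those of `b` do. -/
theorem span_le_of_blockTriangular {Λ : Type*} [PartialOrder Λ] [Finite Λ] {I J : Λ → Type*}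
    {b : (Σ lam, I lam) → M} {z : (Σ lam, J lam) → M}
    (h : ∀ i, b i ∈ Submodule.span R (z '' {j | j.1 = i.1}) ⊔
      Submodule.span R (b '' {k | i.1 < k.1})) {U : Set Λ} (hU : IsUpperSet U) :
    Submodule.span R (b '' {i | i.1 ∈ U}) ≤ Submodule.span R (z '' {j | j.1 ∈ U}) := by
  rw [Submodule.span_le]
  suffices H : ∀ lam ∈ U, ∀ i, b ⟨lam, i⟩ ∈ Submodule.span R (z '' {j | j.1 ∈ U}) by
    rintro _ ⟨⟨lam, i⟩, hi, rfl⟩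
    exact H lam hi i
  intro lam
  induction lam using WellFoundedGT.induction with
  | ind lam ih =>
  intro hlam i
  refine (sup_le ?_ ?_ :
    Submodule.span R (z '' {j | j.1 = lam}) ⊔ Submodule.span R (b '' {k | lam < k.1}) ≤ _)
    (h ⟨lam, i⟩)
  · refine Submodule.span_mono (Set.image_mono ?_)
    rintro j rfl
    exact hlam
  · rw [Submodule.span_le]
    rintro _ ⟨⟨μ, k⟩, hk, rfl⟩
    exact ih μ hk (hU (le_of_lt hk) hlam) k

/-- A spanning family with as many members as a finite basis is linearly independent. -/
theorem Module.Basis.linearIndependent_of_span_eq_top {ι κ : Type*} [Finite ι]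
    (b : Module.Basis ι R M) (e : ι ≃ κ) {z : κ → M} (hz : Submodule.span R (Set.range z) = ⊤) :
    LinearIndependent R z := by
  have : Module.Finite R M := Module.Finite.of_basis b
  have hsurj : Function.Surjective (b.constr R (z ∘ e)) := by
    rw [← LinearMap.range_eq_top, Module.Basis.constr_range, e.surjective.range_comp, hz]
  have hinj := OrzechProperty.injective_of_surjective_endomorphism _ hsurj
  have h := b.linearIndependent.map' _ (LinearMap.ker_eq_bot.2 hinj)
  have h2 : (b.constr R (z ∘ e)) ∘ b = z ∘ e := funext fun i => b.constr_basis R _ i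
  rw [h2] at h
  exact (linearIndependent_equiv e).1 h

end blockTriangular

/-! ### The Murphy basis -/

namespace DiagramTower

variable {R : Type*} [CommRing R] [IsDomain R] {A : ℕ → Type*} [∀ r, Ring (A r)]
  [∀ r, Algebra R (A r)] {Λ : ℕ → Type*} [∀ r, PartialOrder (Λ r)] [∀ r, Finite (Λ r)]
  {T : ∀ r, Λ r → Type*} [∀ r lam, Finite (T r lam)] (D : DiagramTower R A Λ T)

theorem δ_ne_zero (r : ℕ) (lam : Λ r) : D.δ r lam ≠ 0 := by
  intro h
  obtain ⟨t⟩ := D.nonempty_index r lam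
  obtain ⟨a, ha⟩ := D.δ_cyclic r lam (Finsupp.single t 1)
  rw [h, map_zero] at ha
  simpa using DFunLike.congr_fun ha t

theorem pathBasisAt_zero : D.PathBasisAt 0 := by
  intro lam
  have hnil : ∀ t : D.Path 0 lam, D.pathVec t = D.δ 0 lam := by
    rintro ⟨_⟩
    rw [pathVec, dPath, CellDatum.act_one]
    rfl
  have : Unique (D.Path 0 lam) := ⟨⟨.nil lam⟩, by rintro ⟨_⟩; rfl⟩
  constructor
  · exact LinearIndependent.of_subsingleton default (by rw [hnil]; exact D.δ_ne_zero 0 lam)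
  · rw [eq_top_iff]
    intro x _
    obtain ⟨a, rfl⟩ := D.δ_cyclic 0 lam x
    obtain ⟨c, rfl⟩ := D.level_zero.2 a
    rw [Algebra.algebraMap_eq_smul_one, ← CellDatum.actHom_apply, map_smul,
      CellDatum.actHom_apply, CellDatum.act_one]
    exact Submodule.smul_mem _ c (Submodule.subset_span ⟨.nil lam, hnil _⟩)

theorem pathBasisAt (D : DiagramTower R A Λ T) : ∀ r, D.PathBasisAt r
  | 0 => D.pathBasisAt_zero
  | r + 1 => fun μ => (D.pathBasis_step (D.pathBasisAt r) μ).1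

/-- The basis of the cell module `Δ(lam)` that consists of the vectors `δ(lam) d_t`. -/
noncomputable def pathBasis (r : ℕ) (lam : Λ r) :
    Module.Basis (D.Path r lam) R (T r lam →₀ R) :=
  Module.Basis.mk (D.pathBasisAt r lam).1 (D.pathBasisAt r lam).2.ge

@[simp]
theorem pathBasis_apply {r : ℕ} {lam : Λ r} (t : D.Path r lam) :
    D.pathBasis r lam t = D.pathVec t :=
  Module.Basis.mk_apply _ _ t

/-- The coordinates of `δ(lam) a` in the path basis of `Δ(lam)`, as a linear map in `a`. -/
noncomputable def coord (r : ℕ) (lam : Λ r) : A r →ₗ[R] (D.Path r lam →₀ R) :=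
  (D.pathBasis r lam).repr.toLinearMap ∘ₗ LinearMap.applyₗ (D.δ r lam) ∘ₗ
    (D.datum r).actHom lam

theorem coord_apply {r : ℕ} {lam : Λ r} (a : A r) :
    D.coord r lam a = (D.pathBasis r lam).repr ((D.datum r).act lam a (D.δ r lam)) := rfl

theorem coord_dPath {r : ℕ} {lam : Λ r} (t : D.Path r lam) :
    D.coord r lam (D.dPath t) = Finsupp.single t 1 := by
  rw [coord_apply]
  change (D.pathBasis r lam).repr (D.pathVec t) = _
  rw [← pathBasis_apply, Module.Basis.repr_self]

theorem linearCombination_coord {r : ℕ} {lam : Λ r} (a : A r) :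
    Finsupp.linearCombination R (fun t => D.pathVec t) (D.coord r lam a) =
      (D.datum r).act lam a (D.δ r lam) := by
  rw [coord_apply]
  convert (D.pathBasis r lam).linearCombination_repr _ using 3
  exact funext fun t => (D.pathBasis_apply t).symm

/-- Modulo the paths through points larger than `lam`, the coordinates of `δ(μ) d_{lam → μ} a` are
those of `δ(lam) a`, carried along the edge from `lam` to `μ`. -/
theorem coord_d_mul_sub_mem {r : ℕ} {lam : Λ r} {μ : Λ (r + 1)} (e : D.Edge lam μ) (a : A r) :
    D.coord (r + 1) μ (D.d r lam μ * D.incl r a) -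
        (D.coord r lam a).mapDomain (fun t => CellTower.Path.cons t e) ∈
      Finsupp.supported R R {p : D.Path (r + 1) μ | ∃ (lam' : Λ r) (v : D.Path r lam')
        (e' : D.Edge lam' μ), lam < lam' ∧ p = .cons v e'} := by
  have h := (D.pathBasis_step (D.pathBasisAt r) μ).2 lam e a _ (D.linearCombination_coord a).symm
  have h2 : Submodule.span R {x | ∃ (lam' : Λ r) (v : D.Path r lam') (e' : D.Edge lam' μ),
      lam < lam' ∧ x = D.pathVec (.cons v e')} ≤ Submodule.span R (D.pathBasis (r + 1) μ ''
      {p : D.Path (r + 1) μ | ∃ (lam' : Λ r) (v : D.Path r lam')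
        (e' : D.Edge lam' μ), lam < lam' ∧ p = .cons v e'}) := by
    refine Submodule.span_mono ?_
    rintro _ ⟨lam', v, e', hlt, rfl⟩
    exact ⟨_, ⟨lam', v, e', hlt, rfl⟩, D.pathBasis_apply _⟩
  have h3 := (Module.Basis.mem_span_image _).1 (h2 h)
  have h4 : (D.pathBasis (r + 1) μ).repr
      (Finsupp.linearCombination R (fun t => D.pathVec (.cons t e)) (D.coord r lam a)) =
      (D.coord r lam a).mapDomain (fun t => CellTower.Path.cons t e) := by
    rw [← (D.pathBasis (r + 1) μ).repr.eq_symm_apply, Module.Basis.repr_symm_apply,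
      Finsupp.linearCombination_mapDomain]
    congr 2
    exact funext fun t => (D.pathBasis_apply _).symm
  rw [map_sub, h4] at h3
  exact h3

theorem lift_eq_bilinComb_repr {r : ℕ} {lam : Λ r} (x y : T r lam →₀ R) :
    (D.datum r).lift lam x y =
      bilinComb R (fun s t => (D.datum r).lift lam (D.pathVec s) (D.pathVec t))
        ((D.pathBasis r lam).repr x) ((D.pathBasis r lam).repr y) := by
  simp only [CellDatum.lift_eq]
  suffices bilinComb R ((D.datum r).c lam) =
      (bilinComb R fun s t => bilinComb R ((D.datum r).c lam) (D.pathVec s) (D.pathVec t)).compl₁₂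
        (D.pathBasis r lam).repr.toLinearMap (D.pathBasis r lam).repr.toLinearMap from
    LinearMap.congr_fun₂ this x y
  refine (D.pathBasis r lam).ext fun s => (D.pathBasis r lam).ext fun t => ?_
  rw [LinearMap.compl₁₂_apply, LinearEquiv.coe_coe, Module.Basis.repr_self,
    Module.Basis.repr_self, bilinComb_single_single, pathBasis_apply, pathBasis_apply]

theorem star_mul_m_mul_sub_lift_mem {r : ℕ} (lam : Λ r) (x y : A r) :
    (D.datum r).star x * D.m r lam * y - (D.datum r).lift lam
      ((D.datum r).act lam x (D.δ r lam)) ((D.datum r).act lam y (D.δ r lam)) ∈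
      (D.datum r).above lam := by
  have h1 := CellDatum.above_mul_mem (CellDatum.mul_above_mem (D.m_spec r lam)
    ((D.datum r).star x)) y
  have h2 := CellDatum.above_mul_mem
    ((D.datum r).star_mul_lift_sub_mem lam (D.δ r lam) (D.δ r lam) x) y
  have h3 := (D.datum r).lift_mul_sub_mem lam
    ((D.datum r).act lam x (D.δ r lam)) (D.δ r lam) y
  rw [mul_sub, sub_mul] at h1
  rw [sub_mul] at h2
  convert add_mem (add_mem h1 h2) h3 using 1
  abel

theorem murphy_sub_lift_mem {r : ℕ} {lam : Λ r} (s t : D.Path r lam) :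
    D.murphy s t - (D.datum r).lift lam (D.pathVec s) (D.pathVec t) ∈ (D.datum r).above lam :=
  D.star_mul_m_mul_sub_lift_mem lam (D.dPath s) (D.dPath t)

/-- Modulo `A^{▷ lam}`, the product `x^* m_lam y` depends only on `δ(lam) x` and `δ(lam) y`. -/
theorem star_mul_m_mul_sub_mem {r : ℕ} (lam : Λ r) (x y : A r) :
    (D.datum r).star x * D.m r lam * y -
      bilinComb R (fun s t => D.murphy s t) (D.coord r lam x) (D.coord r lam y) ∈
      (D.datum r).above lam := by
  have h1 := D.star_mul_m_mul_sub_lift_mem lam x y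
  have h2 := bilinComb_sub_mem _ (fun s t => D.murphy_sub_lift_mem s t)
    (D.coord r lam x) (D.coord r lam y)
  rw [D.lift_eq_bilinComb_repr] at h1
  convert sub_mem h1 h2 using 1
  simp only [coord_apply]
  abel

theorem murphy_mem_cellSpan {r : ℕ} {U : Set (Λ r)} (hU : IsUpperSet U) {lam : Λ r}
    (h : lam ∈ U) (s t : D.Path r lam) : D.murphy s t ∈ (D.datum r).cellSpan U := by
  have h1 := (D.datum r).above_le_cellSpan hU h (D.murphy_sub_lift_mem s t)
  rw [← sub_add_cancel (D.murphy s t) ((D.datum r).lift lam (D.pathVec s) (D.pathVec t))]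
  refine add_mem h1 (Submodule.sum_mem _ fun p _ => Submodule.sum_mem _ fun q _ =>
    Submodule.smul_mem _ _ (CellDatum.c_mem_cellSpan h p q))

/-- The Murphy basis elements as a family over all pairs of paths. -/
def murphyFamily (r : ℕ) (i : Σ lam : Λ r, D.Path r lam × D.Path r lam) : A r :=
  D.murphy i.2.1 i.2.2

theorem cellSpan_eq_span_murphy {r : ℕ} {U : Set (Λ r)} (hU : IsUpperSet U) :
    (D.datum r).cellSpan U = Submodule.span R (D.murphyFamily r '' {i | i.1 ∈ U}) := by
  refine le_antisymm (span_le_of_blockTriangular ?_ hU) ?_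
  · rintro ⟨lam, p, q⟩
    have h1 := bilinComb_sub_mem _ (fun s t => D.murphy_sub_lift_mem s t)
      ((D.pathBasis r lam).repr (Finsupp.single p 1))
      ((D.pathBasis r lam).repr (Finsupp.single q 1))
    rw [← D.lift_eq_bilinComb_repr, CellDatum.lift_eq, bilinComb_single_single] at h1
    have h2 := bilinComb_mem (Submodule.span R (D.murphyFamily r '' {j | j.1 = lam}))
      (f := fun s t => D.murphy s t) (fun s t => Submodule.subset_span ⟨⟨lam, s, t⟩, rfl, rfl⟩)
      ((D.pathBasis r lam).repr (Finsupp.single p 1))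
      ((D.pathBasis r lam).repr (Finsupp.single q 1))
    rw [CellDatum.above_eq] at h1
    have h3 := sub_mem (Submodule.mem_sup_left h2) (Submodule.mem_sup_right h1)
    rw [sub_sub_cancel] at h3
    exact h3
  · rw [Submodule.span_le]
    rintro _ ⟨⟨lam, s, t⟩, h, rfl⟩
    exact D.murphy_mem_cellSpan hU h s t

theorem span_murphyFamily (r : ℕ) : Submodule.span R (Set.range (D.murphyFamily r)) = ⊤ := by
  have h := D.cellSpan_eq_span_murphy (isUpperSet_univ : IsUpperSet (Set.univ : Set (Λ r)))
  simp only [CellDatum.cellSpan, Set.mem_univ, Set.ofPred_true, Set.image_univ] at h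
  rw [← h, Module.Basis.span_eq]

theorem linearIndependent_murphyFamily (r : ℕ) : LinearIndependent R (D.murphyFamily r) := by
  refine (D.datum r).basis.linearIndependent_of_span_eq_top
    (Equiv.sigmaCongrRight fun lam => ?_) (D.span_murphyFamily r)
  let e : T r lam ≃ D.Path r lam := Finsupp.basisSingleOne.indexEquiv (D.pathBasis r lam)
  exact e.prodCongr e

/-- The Murphy basis `m^lam_{st}` of `A_r`. -/
noncomputable def murphyBasis (r : ℕ) :
    Module.Basis (Σ lam : Λ r, D.Path r lam × D.Path r lam) R (A r) :=
  Module.Basis.mk (D.linearIndependent_murphyFamily r) (D.span_murphyFamily r).ge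

theorem murphyBasis_apply {r : ℕ} {lam : Λ r} (s t : D.Path r lam) :
    D.murphyBasis r ⟨lam, s, t⟩ = D.murphy s t :=
  Module.Basis.mk_apply _ _ _

theorem above_eq_span_murphyBasis {r : ℕ} (lam : Λ r) :
    (D.datum r).above lam = Submodule.span R (D.murphyBasis r '' {i | lam < i.1}) := by
  rw [CellDatum.above_eq, D.cellSpan_eq_span_murphy (isUpperSet_Ioi lam)]
  congr 2
  exact funext fun i => (D.murphyBasis_apply i.2.1 i.2.2).symm

end DiagramTower

/-! ### Extension of scalars -/

namespace DiagramTower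

section baseChange

variable {R : Type*} [CommRing R] [IsDomain R] {A : ℕ → Type*} [∀ r, Ring (A r)]
  [∀ r, Algebra R (A r)] {Λ : ℕ → Type*} [∀ r, PartialOrder (Λ r)] [∀ r, Finite (Λ r)]
  {T : ∀ r, Λ r → Type*} [∀ r lam, Finite (T r lam)] (D : DiagramTower R A Λ T)
  (E : Type*) [CommRing E] [Algebra R E]

@[simp]
theorem inclBase_tmul (r : ℕ) (p : E) (a : A r) :
    D.inclBase E r (p ⊗ₜ[R] a) = p ⊗ₜ[R] D.incl r a := rfl

@[simp]
theorem starBase_tmul (r : ℕ) (p : E) (a : A r) :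
    D.starBase E r (p ⊗ₜ[R] a) = p ⊗ₜ[R] (D.datum r).star a := rfl

variable {E}

theorem starBase_mul {r : ℕ} (x y : E ⊗[R] A r) :
    D.starBase E r (x * y) = D.starBase E r y * D.starBase E r x := by
  induction x using TensorProduct.induction_on with
  | zero => simp
  | add x x' hx hx' => rw [add_mul, map_add, hx, hx', map_add, mul_add]
  | tmul p a =>
    induction y using TensorProduct.induction_on with
    | zero => simp
    | add y y' hy hy' => rw [mul_add, map_add, hy, hy', map_add, add_mul]
    | tmul q b =>
      simp only [Algebra.TensorProduct.tmul_mul_tmul, starBase_tmul, CellDatum.star_mul, mul_comm]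

@[simp]
theorem starBase_starBase {r : ℕ} (x : E ⊗[R] A r) : D.starBase E r (D.starBase E r x) = x := by
  induction x using TensorProduct.induction_on with
  | zero => simp
  | add x x' hx hx' => rw [map_add, map_add, hx, hx']
  | tmul p a => simp [CellDatum.star_star]

theorem starBase_inclBase {r : ℕ} (x : E ⊗[R] A r) :
    D.starBase E (r + 1) (D.inclBase E r x) = D.inclBase E r (D.starBase E r x) := by
  induction x using TensorProduct.induction_on with
  | zero => simp
  | add x x' hx hx' => rw [map_add, map_add, hx, hx', map_add, map_add]
  | tmul p a => simp [D.incl_star]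

theorem starBase_m {r : ℕ} (lam : Λ r) :
    D.starBase E r (1 ⊗ₜ[R] D.m r lam) = 1 ⊗ₜ[R] D.m r lam := by
  rw [starBase_tmul, D.m_star]

theorem compatBase {r : ℕ} {lam : Λ r} {μ : Λ (r + 1)} (e : D.Edge lam μ) :
    (1 ⊗ₜ[R] D.m (r + 1) μ * 1 ⊗ₜ[R] D.d r lam μ : E ⊗[R] A (r + 1)) =
      D.starBase E (r + 1) (1 ⊗ₜ[R] D.u r lam μ) * D.inclBase E r (1 ⊗ₜ[R] D.m r lam) := by
  rw [starBase_tmul, inclBase_tmul, Algebra.TensorProduct.tmul_mul_tmul,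
    Algebra.TensorProduct.tmul_mul_tmul, D.compat r lam μ e]

theorem one_tmul_dPath_cons {r : ℕ} {lam : Λ r} {μ : Λ (r + 1)} (t : D.Path r lam)
    (e : D.Edge lam μ) :
    (1 ⊗ₜ[R] D.dPath (.cons t e) : E ⊗[R] A (r + 1)) =
      1 ⊗ₜ[R] D.d r lam μ * D.inclBase E r (1 ⊗ₜ[R] D.dPath t) := by
  rw [inclBase_tmul, Algebra.TensorProduct.tmul_mul_tmul, one_mul]
  rfl

theorem one_tmul_murphy {r : ℕ} {lam : Λ r} (s t : D.Path r lam) :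
    (1 ⊗ₜ[R] D.murphy s t : E ⊗[R] A r) =
      D.starBase E r (1 ⊗ₜ[R] D.dPath s) * 1 ⊗ₜ[R] D.m r lam * 1 ⊗ₜ[R] D.dPath t := by
  rw [starBase_tmul, Algebra.TensorProduct.tmul_mul_tmul, Algebra.TensorProduct.tmul_mul_tmul,
    one_mul, one_mul]
  rfl

theorem starBase_murphy {r : ℕ} {lam : Λ r} (s t : D.Path r lam) :
    D.starBase E r (1 ⊗ₜ[R] D.murphy s t) = 1 ⊗ₜ[R] D.murphy t s := by
  rw [one_tmul_murphy, one_tmul_murphy, starBase_mul, starBase_mul, starBase_starBase, starBase_m,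
    mul_assoc]

theorem aboveBase_induction {r : ℕ} {lam : Λ r} {p : E ⊗[R] A r → Prop}
    (tmul : ∀ a ∈ (D.datum r).above lam, p (1 ⊗ₜ[R] a)) (zero : p 0)
    (add : ∀ x y, p x → p y → p (x + y)) (smul : ∀ (c : E) x, p x → p (c • x))
    {x : E ⊗[R] A r} (hx : x ∈ D.aboveBase E r lam) : p x := by
  rw [aboveBase, Submodule.baseChange_eq_span] at hx
  refine Submodule.span_induction (p := fun x _ => p x) ?_ zero (fun x y _ _ => add x y)
    (fun c x _ => smul c x) hx
  rintro _ ⟨a, ha, rfl⟩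
  exact tmul a ha

theorem tmul_mem_aboveBase {r : ℕ} {lam : Λ r} {a : A r} (ha : a ∈ (D.datum r).above lam) (p : E) :
    p ⊗ₜ[R] a ∈ D.aboveBase E r lam :=
  Submodule.tmul_mem_baseChange_of_mem p ha

variable {D}

theorem starBase_mem_aboveBase {r : ℕ} {lam : Λ r} {x : E ⊗[R] A r}
    (hx : x ∈ D.aboveBase E r lam) : D.starBase E r x ∈ D.aboveBase E r lam := by
  refine D.aboveBase_induction (p := fun x => D.starBase E r x ∈ D.aboveBase E r lam)
    (fun a ha => D.tmul_mem_aboveBase (CellDatum.star_mem_above ha) 1) (by simp)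
    (fun x y hx hy => ?_) (fun c x hx => ?_) hx
  · rw [map_add]; exact add_mem hx hy
  · rw [map_smul]; exact Submodule.smul_mem _ c hx

theorem aboveBase_mul_mem {r : ℕ} {lam : Λ r} {x : E ⊗[R] A r}
    (hx : x ∈ D.aboveBase E r lam) (y : E ⊗[R] A r) : x * y ∈ D.aboveBase E r lam := by
  refine D.aboveBase_induction (p := fun x => x * y ∈ D.aboveBase E r lam)
    (fun a ha => ?_) (by simp) (fun x y hx hy => ?_) (fun c x hx => ?_) hx
  · induction y using TensorProduct.induction_on with
    | zero => simp
    | add y y' hy hy' => rw [mul_add]; exact add_mem hy hy'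
    | tmul q b =>
      rw [Algebra.TensorProduct.tmul_mul_tmul]
      exact D.tmul_mem_aboveBase (CellDatum.above_mul_mem ha b) _
  · rw [add_mul]; exact add_mem hx hy
  · rw [smul_mul_assoc]; exact Submodule.smul_mem _ c hx

theorem mul_aboveBase_mem {r : ℕ} {lam : Λ r} {x : E ⊗[R] A r}
    (hx : x ∈ D.aboveBase E r lam) (y : E ⊗[R] A r) : y * x ∈ D.aboveBase E r lam := by
  rw [← D.starBase_starBase (y * x), D.starBase_mul]
  exact starBase_mem_aboveBase (aboveBase_mul_mem (starBase_mem_aboveBase hx) _)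

variable (D E)

/-- The Murphy basis of `A_r^E`. -/
noncomputable def murphyBase (r : ℕ) :
    Module.Basis (Σ lam : Λ r, D.Path r lam × D.Path r lam) E (E ⊗[R] A r) :=
  (D.murphyBasis r).baseChange E

variable {E} in
theorem murphyBase_apply {r : ℕ} {lam : Λ r} (s t : D.Path r lam) :
    D.murphyBase E r ⟨lam, s, t⟩ = 1 ⊗ₜ[R] D.murphy s t := by
  rw [murphyBase, Module.Basis.baseChange_apply, murphyBasis_apply]

theorem aboveBase_eq_span {r : ℕ} (lam : Λ r) :
    D.aboveBase E r lam = Submodule.span E (D.murphyBase E r '' {i | lam < i.1}) := by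
  rw [aboveBase, above_eq_span_murphyBasis, Submodule.baseChange_span, Set.image_image]
  congr 2
  exact funext fun i => (Module.Basis.baseChange_apply _ _ _).symm

variable {D E}

theorem mem_aboveBase {r : ℕ} {lam : Λ r} {x : E ⊗[R] A r} :
    x ∈ D.aboveBase E r lam ↔ ∀ i, ¬ lam < i.1 → (D.murphyBase E r).repr x i = 0 := by
  rw [aboveBase_eq_span, Module.Basis.mem_span_image]
  constructor
  · intro h i hi
    by_contra h0
    exact hi (h (Finsupp.mem_support_iff.2 h0))
  · intro h i hi
    by_contra h0
    exact Finsupp.mem_support_iff.1 hi (h i h0)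

variable (D E)

open Classical in
/-- The coordinates of `δ(lam) a` in the path basis of the cell module, for `a` in `A_r^E`. -/
noncomputable def coordBase (r : ℕ) (lam : Λ r) : E ⊗[R] A r →ₗ[E] (D.Path r lam →₀ E) :=
  (TensorProduct.finsuppScalarRight R E E (D.Path r lam)).toLinearMap ∘ₗ
    (D.coord r lam).baseChange E

variable {E}

theorem coordBase_tmul_apply {r : ℕ} (lam : Λ r) (p : E) (a : A r) (t : D.Path r lam) :
    D.coordBase E r lam (p ⊗ₜ[R] a) t = D.coord r lam a t • p := by
  simp [coordBase, TensorProduct.finsuppScalarRight_apply_tmul_apply]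

theorem coordBase_tmul {r : ℕ} (lam : Λ r) (p : E) (a : A r) :
    D.coordBase E r lam (p ⊗ₜ[R] a) =
      p • (D.coord r lam a).mapRange (algebraMap R E) (map_zero _) := by
  ext t
  rw [coordBase_tmul_apply, Finsupp.smul_apply, Finsupp.mapRange_apply, Algebra.smul_def,
    smul_eq_mul, mul_comm]

theorem coordBase_dPath {r : ℕ} {lam : Λ r} (t : D.Path r lam) :
    D.coordBase E r lam (1 ⊗ₜ[R] D.dPath t) = Finsupp.single t 1 := by
  rw [coordBase_tmul, coord_dPath, Finsupp.mapRange_single, map_one, one_smul]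

/-- The bilinear combination of the Murphy basis elements of the cell `lam` with given
coordinates. -/
noncomputable abbrev murphyComb {r : ℕ} {lam : Λ r} :
    (D.Path r lam →₀ E) →ₗ[E] (D.Path r lam →₀ E) →ₗ[E] E ⊗[R] A r :=
  bilinComb E fun s t => 1 ⊗ₜ[R] D.murphy s t

theorem murphyComb_mapRange {r : ℕ} {lam : Λ r} (x y : D.Path r lam →₀ R) :
    D.murphyComb (x.mapRange (algebraMap R E) (map_zero _))
      (y.mapRange (algebraMap R E) (map_zero _)) =
      1 ⊗ₜ[R] bilinComb R (fun s t => D.murphy s t) x y :=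
  bilinComb_mapRange (TensorProduct.mk R E (A r) 1) _ x y

/-- Modulo `(A_r^E)^{▷ lam}`, the product `x^* m_lam y` depends only on `δ(lam) x` and
`δ(lam) y`. -/
theorem starBase_mul_m_mul_sub_mem {r : ℕ} (lam : Λ r) (x y : E ⊗[R] A r) :
    D.starBase E r x * 1 ⊗ₜ[R] D.m r lam * y -
      D.murphyComb (D.coordBase E r lam x) (D.coordBase E r lam y) ∈ D.aboveBase E r lam := by
  induction x using TensorProduct.induction_on with
  | zero => simp
  | add x x' hx hx' =>
    rw [map_add, add_mul, add_mul, map_add, map_add, LinearMap.add_apply, add_sub_add_comm]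
    exact add_mem hx hx'
  | tmul p a =>
    induction y using TensorProduct.induction_on with
    | zero => simp
    | add y y' hy hy' =>
      rw [mul_add, map_add, map_add, add_sub_add_comm]
      exact add_mem hy hy'
    | tmul q b =>
      rw [coordBase_tmul, coordBase_tmul, map_smul, map_smul, LinearMap.smul_apply,
        D.murphyComb_mapRange, starBase_tmul, Algebra.TensorProduct.tmul_mul_tmul,
        Algebra.TensorProduct.tmul_mul_tmul, mul_one, TensorProduct.smul_tmul',
        TensorProduct.smul_tmul', smul_eq_mul, smul_eq_mul, mul_one, mul_comm q p,
        ← TensorProduct.tmul_sub]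
      exact D.tmul_mem_aboveBase (D.star_mul_m_mul_sub_mem lam a b) _

theorem repr_murphyComb_single {r : ℕ} {lam : Λ r} (s t : D.Path r lam) (y : D.Path r lam →₀ E) :
    (D.murphyBase E r).repr (D.murphyComb (Finsupp.single s 1) y) ⟨lam, s, t⟩ = y t := by
  classical
  rw [bilinComb_single, one_smul]
  simp only [← murphyBase_apply]
  rw [Finsupp.linearCombination_apply, Finsupp.sum, map_sum, Finsupp.finsetSum_apply]
  simp only [map_smul, Module.Basis.repr_self, Finsupp.smul_apply, smul_eq_mul]
  rw [Finset.sum_eq_single t]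
  · simp
  · intro b _ hb
    rw [Finsupp.single_apply, if_neg, mul_zero]
    simpa using hb
  · intro h
    simpa using h

/-- The coordinates of `δ(lam) y` can be read off from the products `d_s^* m_lam y`. -/
theorem repr_starBase_mul_m_mul {r : ℕ} {lam : Λ r} (s t : D.Path r lam) (y : E ⊗[R] A r) :
    (D.murphyBase E r).repr
      (D.starBase E r (1 ⊗ₜ[R] D.dPath s) * 1 ⊗ₜ[R] D.m r lam * y) ⟨lam, s, t⟩ =
      D.coordBase E r lam y t := by
  have h := mem_aboveBase.1 (D.starBase_mul_m_mul_sub_mem lam (1 ⊗ₜ[R] D.dPath s) y)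
    ⟨lam, s, t⟩ (lt_irrefl lam)
  rw [coordBase_dPath, map_sub, Finsupp.sub_apply, repr_murphyComb_single, sub_eq_zero] at h
  exact h

theorem coordBase_d_mul_sub_mem {r : ℕ} {lam : Λ r} {μ : Λ (r + 1)} (e : D.Edge lam μ)
    (x : E ⊗[R] A r) :
    D.coordBase E (r + 1) μ (1 ⊗ₜ[R] D.d r lam μ * D.inclBase E r x) -
        (D.coordBase E r lam x).mapDomain (fun t => CellTower.Path.cons t e) ∈
      Finsupp.supported E E {p : D.Path (r + 1) μ | ∃ (lam' : Λ r) (v : D.Path r lam')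
        (e' : D.Edge lam' μ), lam < lam' ∧ p = .cons v e'} := by
  induction x using TensorProduct.induction_on with
  | zero => simp
  | add x x' hx hx' =>
    rw [map_add, mul_add, map_add, map_add, Finsupp.mapDomain_add, add_sub_add_comm]
    exact add_mem hx hx'
  | tmul p a =>
    rw [inclBase_tmul, Algebra.TensorProduct.tmul_mul_tmul, one_mul, coordBase_tmul,
      coordBase_tmul, Finsupp.mapDomain_smul, ← smul_sub]
    refine Submodule.smul_mem _ _ ?_
    have h := D.coord_d_mul_sub_mem e a
    rw [Finsupp.mem_supported'] at h ⊢
    intro v hv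
    have h2 := congrArg (algebraMap R E) (h v hv)
    rw [Finsupp.sub_apply, map_sub, map_zero] at h2
    rw [Finsupp.sub_apply, Finsupp.mapRange_apply]
    convert h2 using 2
    rw [Finsupp.mapDomain_mapRange _ _ _ _ (map_add _), Finsupp.mapRange_apply]

end baseChange

end DiagramTower

/-! ### An order on paths -/

/-- A family of vectors that is unitriangular for a well-founded relation spans. -/
theorem Finsupp.span_eq_top_of_unitriangular {ι E : Type*} [CommRing E] {rel : ι → ι → Prop}
    (hwf : WellFounded fun v t => rel t v) {f : ι → ι →₀ E}
    (h : ∀ t, f t - Finsupp.single t 1 ∈ Finsupp.supported E E {v | rel t v}) :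
    Submodule.span E (Set.range f) = ⊤ := by
  have key : ∀ t, Finsupp.single t 1 ∈ Submodule.span E (Set.range f) := by
    intro t
    induction t using hwf.induction with
    | _ t ih =>
    rw [← sub_sub_cancel (f t) (Finsupp.single t 1)]
    refine sub_mem (Submodule.subset_span ⟨t, rfl⟩) ?_
    have h1 := h t
    rw [Finsupp.supported_eq_span_single] at h1
    refine Submodule.span_le.2 ?_ h1
    rintro _ ⟨v, hv, rfl⟩
    exact ih v hv
  rw [eq_top_iff, ← (Finsupp.basisSingleOne (R := E) (ι := ι)).span_eq, Submodule.span_le]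
  rintro _ ⟨t, rfl⟩
  simpa using key t

namespace CellTower

variable {R : Type*} [CommRing R] {A : ℕ → Type*} [∀ r, Ring (A r)]
  [∀ r, Algebra R (A r)] {Λ : ℕ → Type*} [∀ r, PartialOrder (Λ r)] [∀ r, Finite (Λ r)]
  {T : ∀ r, Λ r → Type*} [∀ r lam, Finite (T r lam)] {C : CellTower R A Λ T}

/-- The reverse lexicographic order on paths with the same end: `t.Lt v` if at the last level at
which `t` and `v` differ the point of `v` is larger than that of `t`. -/
inductive Path.Lt : ∀ {r : ℕ} {lam : Λ r}, C.Path r lam → C.Path r lam → Prop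
  | last {r : ℕ} {lam lam' : Λ r} {μ : Λ (r + 1)} (t : C.Path r lam) (v : C.Path r lam')
      (e : C.Edge lam μ) (e' : C.Edge lam' μ) (h : lam < lam') : Lt (.cons t e) (.cons v e')
  | tail {r : ℕ} {lam : Λ r} {μ : Λ (r + 1)} (t v : C.Path r lam) (e : C.Edge lam μ)
      (h : Lt t v) : Lt (.cons t e) (.cons v e)

theorem Path.acc_lt : ∀ {r : ℕ} {lam : Λ r} (t : C.Path r lam), Acc (fun v t => Path.Lt t v) t
  | _, _, .nil _ => ⟨_, by rintro _ ⟨⟩⟩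
  | r + 1, μ, .cons (lam := lam) t e => by
    induction lam using WellFoundedGT.induction with
    | ind lam ih =>
    have ht := Path.acc_lt t
    induction ht with
    | intro t _ iht =>
    refine ⟨_, ?_⟩
    intro v hv
    cases hv with
    | last _ v _ e' h => exact ih _ h v e'
    | tail _ v _ h => exact iht v h

theorem Path.wellFounded_lt (r : ℕ) (lam : Λ r) :
    WellFounded fun v t : C.Path r lam => Path.Lt t v :=
  ⟨Path.acc_lt⟩

theorem Path.Perm.mem {P : ∀ r, Set (Λ r)} :
    ∀ {r : ℕ} {lam : Λ r} {t : C.Path r lam}, t.Perm P → lam ∈ P r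
  | _, _, .nil _, h => h
  | _, _, .cons _ _, h => h.2

end CellTower

/-! ### The specializations over `S` and over `K` -/

section specMap

variable {R : Type*} [CommRing R] {A : ℕ → Type*} [∀ r, Ring (A r)]
  [∀ r, Algebra R (A r)] {Λ : ℕ → Type*} [∀ r, PartialOrder (Λ r)] [∀ r, Finite (Λ r)]
  {T : ∀ r, Λ r → Type*} [∀ r lam, Finite (T r lam)]
  {S K : Type*} [CommRing S] [Field K] [Algebra R S] [Algebra R K]
  [Algebra S K] [IsScalarTower R S K]

theorem specMap_tmul {B : Type*} [Ring B] [Algebra R B] (p : S) (b : B) :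
    specMap R S K B (p ⊗ₜ[R] b) = algebraMap S K p ⊗ₜ[R] b := rfl

theorem specMap_one_tmul {B : Type*} [Ring B] [Algebra R B] (b : B) :
    specMap R S K B (1 ⊗ₜ[R] b) = 1 ⊗ₜ[R] b := by
  rw [specMap_tmul, map_one]

namespace DiagramTower

variable [IsDomain R] (D : DiagramTower R A Λ T)

theorem specMap_inclBase {r : ℕ} (x : S ⊗[R] A r) :
    specMap R S K (A (r + 1)) (D.inclBase S r x) = D.inclBase K r (specMap R S K (A r) x) := by
  induction x using TensorProduct.induction_on with
  | zero => simp
  | add x y hx hy => simp only [map_add, hx, hy]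
  | tmul p a => rfl

theorem specMap_starBase {r : ℕ} (x : S ⊗[R] A r) :
    specMap R S K (A r) (D.starBase S r x) = D.starBase K r (specMap R S K (A r) x) := by
  induction x using TensorProduct.induction_on with
  | zero => simp
  | add x y hx hy => simp only [map_add, hx, hy]
  | tmul p a => rfl

theorem specMap_murphyBase {r : ℕ} (i : Σ lam : Λ r, D.Path r lam × D.Path r lam) :
    specMap R S K (A r) (D.murphyBase S r i) = D.murphyBase K r i := by
  obtain ⟨lam, s, t⟩ := i
  rw [murphyBase_apply, murphyBase_apply, specMap_one_tmul]

theorem repr_specMap {r : ℕ} (x : S ⊗[R] A r)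
    (i : Σ lam : Λ r, D.Path r lam × D.Path r lam) :
    (D.murphyBase K r).repr (specMap R S K (A r) x) i =
      algebraMap S K ((D.murphyBase S r).repr x i) := by
  classical
  suffices h : (Finsupp.lapply i : (_ →₀ K) →ₗ[K] K).restrictScalars S ∘ₗ
      (D.murphyBase K r).repr.toLinearMap.restrictScalars S ∘ₗ (specMap R S K (A r)).toLinearMap =
      Algebra.linearMap S K ∘ₗ Finsupp.lapply i ∘ₗ (D.murphyBase S r).repr.toLinearMap from
    LinearMap.congr_fun h x
  refine (D.murphyBase S r).ext fun j => ?_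
  simp only [LinearMap.comp_apply, LinearMap.restrictScalars_apply, AlgHom.toLinearMap_apply,
    LinearEquiv.coe_coe, Finsupp.lapply_apply, specMap_murphyBase, Module.Basis.repr_self,
    Algebra.linearMap_apply, Finsupp.single_apply]
  split_ifs <;> simp

theorem specMap_mem_aboveBase {r : ℕ} {lam : Λ r} {x : S ⊗[R] A r}
    (hx : x ∈ D.aboveBase S r lam) : specMap R S K (A r) x ∈ D.aboveBase K r lam := by
  rw [mem_aboveBase] at *
  intro i hi
  rw [repr_specMap, hx i hi, map_zero]

theorem specMap_injective (D : DiagramTower R A Λ T) [IsFractionRing S K] (r : ℕ) :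
    Function.Injective (specMap R S K (A r)) := by
  intro x y h
  refine (D.murphyBase S r).repr.injective (Finsupp.ext fun i => ?_)
  refine IsFractionRing.injective S K ?_
  rw [← repr_specMap, ← repr_specMap, h]

theorem mem_aboveBase_of_specMap [IsFractionRing S K] {r : ℕ} {lam : Λ r} {x : S ⊗[R] A r}
    (hx : specMap R S K (A r) x ∈ D.aboveBase K r lam) : x ∈ D.aboveBase S r lam := by
  rw [mem_aboveBase] at *
  intro i hi
  refine IsFractionRing.injective S K ?_
  rw [← repr_specMap, hx i hi, map_zero]

theorem coordBase_specMap {r : ℕ} (lam : Λ r) (x : S ⊗[R] A r) :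
    D.coordBase K r lam (specMap R S K (A r) x) =
      (D.coordBase S r lam x).mapRange (algebraMap S K) (map_zero _) := by
  ext v
  rw [← repr_starBase_mul_m_mul D v, Finsupp.mapRange_apply, ← repr_starBase_mul_m_mul D v,
    ← repr_specMap, map_mul (specMap R S K (A r)), map_mul (specMap R S K (A r)),
    specMap_starBase, specMap_one_tmul, specMap_one_tmul]

theorem specMap_murphyComb {r : ℕ} {lam : Λ r} (x y : D.Path r lam →₀ S) :
    specMap R S K (A r) (D.murphyComb x y) =
      D.murphyComb (x.mapRange (algebraMap S K) (map_zero _))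
        (y.mapRange (algebraMap S K) (map_zero _)) := by
  have h := bilinComb_mapRange (R := S) (E := K) (specMap R S K (A r)).toLinearMap
    (fun s t : D.Path r lam => 1 ⊗ₜ[R] D.murphy s t) x y
  simp only [AlgHom.toLinearMap_apply, specMap_one_tmul] at h
  exact h.symm

end DiagramTower

end specMap

/-! ### The modified elements -/

namespace QuotientTower

variable {R : Type*} [CommRing R] [IsDomain R] {A : ℕ → Type*} [∀ r, Ring (A r)]
  [∀ r, Algebra R (A r)] {Λ : ℕ → Type*} [∀ r, PartialOrder (Λ r)] [∀ r, Finite (Λ r)]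
  {T : ∀ r, Λ r → Type*} [∀ r lam, Finite (T r lam)] {D : DiagramTower R A Λ T}
  {S K : Type*} [CommRing S] [Field K] [Algebra R S] [Algebra R K]
  [Algebra S K] [IsScalarTower R S K]
  {Q : ℕ → Type*} [∀ r, Ring (Q r)] [∀ r, Algebra K (Q r)]
  (W : QuotientTower D S K Q)

theorem aPath_of_perm (β : ∀ k, Λ (k + 1) → K ⊗[R] A (k + 1)) {r : ℕ} {lam : Λ r}
    {t : D.Path r lam} (ht : t.Perm W.perm) : W.aPath β t = 1 ⊗ₜ[R] D.dPath t := by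
  cases t with
  | nil => rfl
  | cons t e => rw [aPath, if_pos ht.1, if_pos ht.2]

open Classical in
/-- An element of `A_r^S` that represents `m_lam a_t`. For a path `t` with first nonpermissible
point `μ` it is `u_{t₂}^* 𝔟_μ d_{t₁}`. -/
noncomputable def nPath (W : QuotientTower D S K Q) :
    ∀ {r : ℕ} {lam : Λ r}, D.Path r lam → S ⊗[R] A r
  | _, _, .nil lam => 1 ⊗ₜ[R] D.m 0 lam
  | _, _, .cons (r := r) (lam := lam) (μ := μ) t e =>
    if t.Perm W.perm then
      if μ ∈ W.perm (r + 1) then 1 ⊗ₜ[R] D.m (r + 1) μ * 1 ⊗ₜ[R] D.dPath (.cons t e)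
      else W.𝔟 r μ * 1 ⊗ₜ[R] D.dPath (.cons t e)
    else D.starBase S (r + 1) (1 ⊗ₜ[R] D.u r lam μ) * D.inclBase S r (W.nPath t)

theorem nPath_of_perm {r : ℕ} {lam : Λ r} {t : D.Path r lam} (ht : t.Perm W.perm) :
    W.nPath t = 1 ⊗ₜ[R] D.m r lam * 1 ⊗ₜ[R] D.dPath t := by
  cases t with
  | nil =>
    rw [nPath, DiagramTower.dPath, ← Algebra.TensorProduct.one_def, mul_one]
  | cons t e => rw [nPath, if_pos ht.1, if_pos ht.2]

theorem isMarginal_of_perm {r : ℕ} {lam : Λ r} {μ : Λ (r + 1)} {t : D.Path r lam}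
    (e : D.Edge lam μ) (ht : t.Perm W.perm) (hμ : μ ∉ W.perm (r + 1)) :
    D.IsMarginal W.perm r μ :=
  ⟨hμ, lam, t, e, ht⟩

/-- The elements `β_μ` satisfy `𝔟_μ = m_μ β_μ` for all marginal points `μ`. -/
def IsModifier (W : QuotientTower D S K Q) (β : ∀ k, Λ (k + 1) → K ⊗[R] A (k + 1)) : Prop :=
  ∀ k μ, D.IsMarginal W.perm k μ →
    specMap R S K _ (W.𝔟 k μ) = 1 ⊗ₜ[R] D.m (k + 1) μ * β k μ

variable {W} {β : ∀ k, Λ (k + 1) → K ⊗[R] A (k + 1)}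

theorem specMap_nPath (hβ : W.IsModifier β) :
    ∀ {r : ℕ} {lam : Λ r} (t : D.Path r lam),
      specMap R S K (A r) (W.nPath t) = 1 ⊗ₜ[R] D.m r lam * W.aPath β t
  | _, _, .nil lam => by rw [nPath, aPath, specMap_one_tmul, mul_one]
  | _, _, .cons (r := r) (lam := lam) (μ := μ) t e => by
    by_cases ht : t.Perm W.perm
    · by_cases hμ : μ ∈ W.perm (r + 1)
      · rw [nPath, aPath, if_pos ht, if_pos ht, if_pos hμ, if_pos hμ, map_mul, specMap_one_tmul,
          specMap_one_tmul]
      · rw [nPath, aPath, if_pos ht, if_pos ht, if_neg hμ, if_neg hμ, map_mul, specMap_one_tmul,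
          hβ r μ (W.isMarginal_of_perm e ht hμ), mul_assoc]
    · rw [nPath, aPath, if_neg ht, if_neg ht, map_mul, D.specMap_starBase, D.specMap_inclBase,
        specMap_nPath hβ t, map_mul, specMap_one_tmul, ← mul_assoc, ← mul_assoc,
        D.compatBase e]

/-- Right multiplication of `m_μ` by `β_μ` does not change the class of `m_μ` in the cell module,
as `𝔟'_μ` lies in `A^{▷ μ}`. -/
theorem coordBase_β_mul (hβ : W.IsModifier β) {r : ℕ} {μ : Λ (r + 1)}
    (hμ : D.IsMarginal W.perm r μ) (x : K ⊗[R] A (r + 1)) :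
    D.coordBase K (r + 1) μ (β r μ * x) = D.coordBase K (r + 1) μ x := by
  ext v
  rw [← D.repr_starBase_mul_m_mul v, ← D.repr_starBase_mul_m_mul v, ← sub_eq_zero,
    ← Finsupp.sub_apply, ← map_sub]
  have h1 : (1 ⊗ₜ[R] D.m (r + 1) μ * β r μ : K ⊗[R] A (r + 1)) - 1 ⊗ₜ[R] D.m (r + 1) μ =
      specMap R S K _ (W.𝔟' r μ) := by
    have h := congrArg (specMap R S K (A (r + 1))) (W.m_eq r μ hμ)
    rw [specMap_one_tmul, map_sub, hβ r μ hμ] at h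
    exact sub_eq_iff_eq_add.2 (sub_eq_iff_eq_add'.1 h.symm)
  rw [mul_assoc _ _ (β r μ * x), mul_assoc _ _ x, ← mul_assoc _ (β r μ) x, ← mul_sub,
    ← sub_mul, h1]
  exact DiagramTower.mem_aboveBase.1 (DiagramTower.mul_aboveBase_mem
    (DiagramTower.aboveBase_mul_mem (D.specMap_mem_aboveBase (W.𝔟'_mem_above r μ hμ)) x) _)
    ⟨μ, v, v⟩ (lt_irrefl μ)

/-- In the cell module, `δ(lam) a_t` is `δ(lam) d_t` up to terms `δ(lam) d_v` with later `v`. -/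
theorem coordBase_aPath_sub_mem (hβ : W.IsModifier β) :
    ∀ {r : ℕ} {lam : Λ r} (t : D.Path r lam),
      D.coordBase K r lam (W.aPath β t) - Finsupp.single t 1 ∈
        Finsupp.supported K K {v | CellTower.Path.Lt t v}
  | _, _, .nil lam => by
    rw [W.aPath_of_perm β (t := .nil lam) (W.perm_zero lam), D.coordBase_dPath, sub_self]
    exact zero_mem _
  | _, _, .cons (r := r) (lam := lam) (μ := μ) t e => by
    by_cases ht : t.Perm W.perm
    · have h : D.coordBase K (r + 1) μ (W.aPath β (.cons t e)) =
          D.coordBase K (r + 1) μ (1 ⊗ₜ[R] D.dPath (.cons t e)) := by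
        by_cases hμ : μ ∈ W.perm (r + 1)
        · rw [W.aPath_of_perm β (t := .cons t e) ⟨ht, hμ⟩]
        · rw [aPath, if_pos ht, if_neg hμ, coordBase_β_mul hβ (W.isMarginal_of_perm e ht hμ)]
      rw [h, D.coordBase_dPath, sub_self]
      exact zero_mem _
    · have ih := coordBase_aPath_sub_mem hβ t
      rw [← D.coordBase_dPath t, ← map_sub] at ih
      have h := D.coordBase_d_mul_sub_mem e (W.aPath β t - 1 ⊗ₜ[R] D.dPath t)
      rw [← D.coordBase_dPath, D.one_tmul_dPath_cons, ← map_sub, aPath, if_neg ht, ← mul_sub,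
        ← map_sub]
      rw [← sub_add_cancel (D.coordBase K (r + 1) μ _)
        (Finsupp.mapDomain (fun t => CellTower.Path.cons t e)
          (D.coordBase K r lam (W.aPath β t - 1 ⊗ₜ[R] D.dPath t)))]
      refine add_mem (Finsupp.supported_mono ?_ h) ?_
      · rintro _ ⟨lam', v, e', hlt, rfl⟩
        exact .last t v e e' hlt
      · classical
        rw [Finsupp.mem_supported] at ih ⊢
        intro p hp
        obtain ⟨v, hv, rfl⟩ := Finset.mem_image.1 (Finsupp.mapDomain_support hp)
        exact .tail t v e (ih hv)

variable (W)

/-- The coordinates over `S` of `δ(lam) a_t` in the path basis of the cell module. They are read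
off from `d_t^* m_lam a_t`, which lies in `A_r^S`. -/
noncomputable def pathCoord {r : ℕ} {lam : Λ r} (t : D.Path r lam) : D.Path r lam →₀ S :=
  Finsupp.equivFunOnFinite.symm fun v =>
    (D.murphyBase S r).repr (D.starBase S r (1 ⊗ₜ[R] D.dPath t) * W.nPath t) ⟨lam, t, v⟩

variable {W}

theorem mapRange_pathCoord (hβ : W.IsModifier β)
    {r : ℕ} {lam : Λ r} (t : D.Path r lam) :
    (W.pathCoord t).mapRange (algebraMap S K) (map_zero _) =
      D.coordBase K r lam (W.aPath β t) := by
  ext v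
  rw [Finsupp.mapRange_apply, pathCoord, Finsupp.equivFunOnFinite_symm_apply_apply,
    ← D.repr_specMap, map_mul, D.specMap_starBase, specMap_one_tmul, specMap_nPath hβ,
    ← mul_assoc, D.repr_starBase_mul_m_mul]

theorem span_coordBase_aPath (hβ : W.IsModifier β) (r : ℕ) (lam : Λ r) :
    Submodule.span K (Set.range fun t : D.Path r lam => D.coordBase K r lam (W.aPath β t)) = ⊤ :=
  Finsupp.span_eq_top_of_unitriangular (CellTower.Path.wellFounded_lt r lam)
    fun t => coordBase_aPath_sub_mem hβ t

variable [IsFractionRing S K]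

theorem span_pathCoord (hβ : W.IsModifier β) (r : ℕ) (lam : Λ r) :
    Submodule.span S (Set.range fun t : D.Path r lam => W.pathCoord t) = ⊤ := by
  refine Finsupp.span_eq_top_of_unitriangular (CellTower.Path.wellFounded_lt r lam) fun t => ?_
  rw [Finsupp.mem_supported']
  intro v hv
  refine IsFractionRing.injective S K ?_
  have h := (Finsupp.mem_supported' _ _).1 (coordBase_aPath_sub_mem hβ t) v hv
  rw [← mapRange_pathCoord hβ, Finsupp.sub_apply, Finsupp.mapRange_apply] at h
  rw [Finsupp.sub_apply, map_sub, map_zero, ← h]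
  classical
  rw [Finsupp.single_apply, Finsupp.single_apply]
  split_ifs <;> simp

/-- Modulo `(A_r^S)^{▷ lam}`, the product `x^* m_lam a_t` depends only on `δ(lam) x`. -/
theorem starBase_mul_nPath_sub_mem (hβ : W.IsModifier β)
    {r : ℕ} {lam : Λ r} (x : S ⊗[R] A r) (t : D.Path r lam) :
    D.starBase S r x * W.nPath t - D.murphyComb (D.coordBase S r lam x) (W.pathCoord t) ∈
      D.aboveBase S r lam := by
  refine D.mem_aboveBase_of_specMap (K := K) ?_
  rw [map_sub, map_mul, D.specMap_starBase, specMap_nPath hβ, D.specMap_murphyComb,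
    mapRange_pathCoord hβ, ← D.coordBase_specMap, ← mul_assoc]
  exact D.starBase_mul_m_mul_sub_mem lam _ _

end QuotientTower

/-! ### Bases adapted to a cell filtration -/

theorem LinearMap.map_mem_of_span_eq_top {E V N ι : Type*} [CommRing E] [AddCommGroup V]
    [Module E V] [AddCommGroup N] [Module E N] {f : ι → V}
    (hf : Submodule.span E (Set.range f) = ⊤) (g : V →ₗ[E] N) {X : Submodule E N}
    (h : ∀ i, g (f i) ∈ X) (x : V) : g x ∈ X := by
  have h1 : Submodule.span E (Set.range f) ≤ X.comap g := by
    rw [Submodule.span_le]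
    rintro _ ⟨i, rfl⟩
    exact h i
  rw [hf] at h1
  exact h1 (Submodule.mem_top (x := x))

/-- A submodule that contains part of a basis and meets the span of the rest trivially has that
part as a basis. -/
theorem Module.Basis.exists_basis_submodule {E V ι : Type*} [CommRing E] [AddCommGroup V]
    [Module E V] (b : Module.Basis ι E V) (p : ι → Prop) (N : Submodule E V)
    (hN : ∀ i, p i → b i ∈ N)
    (hN0 : ∀ x ∈ N, x ∈ Submodule.span E (b '' {i | ¬ p i}) → x = 0) :
    ∃ B : Module.Basis {i // p i} E N, ∀ i, (B i).1 = b i.1 := by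
  classical
  let v : {i // p i} → N := fun i => ⟨b i.1, hN i.1 i.2⟩
  have hli : LinearIndependent E v :=
    LinearIndependent.of_comp N.subtype (b.linearIndependent.comp _ Subtype.val_injective)
  have hsp : ⊤ ≤ Submodule.span E (Set.range v) := by
    rintro ⟨x, hx⟩ -
    set y : V := Finsupp.linearCombination E b ((b.repr x).filter p) with hy
    set y' : V := Finsupp.linearCombination E b ((b.repr x).filter fun i => ¬ p i) with hy'
    have hxy : x = y + y' := by
      rw [hy, hy', ← map_add, Finsupp.filter_add_filter_not, b.linearCombination_repr]
    have hyv : y ∈ Submodule.span E (N.subtype '' Set.range v) := by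
      rw [hy, Finsupp.linearCombination_apply, Finsupp.sum]
      refine Submodule.sum_mem _ fun i hi => Submodule.smul_mem _ _ (Submodule.subset_span ?_)
      rw [Finsupp.support_filter, Finset.mem_filter] at hi
      exact ⟨v ⟨i, hi.2⟩, ⟨_, rfl⟩, rfl⟩
    rw [← Submodule.map_span] at hyv
    obtain ⟨z, hz, hzy⟩ := hyv
    have hy'0 : y' = 0 := by
      refine hN0 y' ?_ ?_
      · have : y' = x - N.subtype z := by rw [hzy, hxy, add_sub_cancel_left]
        rw [this]
        exact sub_mem hx z.2
      · rw [hy', Finsupp.linearCombination_apply, Finsupp.sum]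
        refine Submodule.sum_mem _ fun i hi => Submodule.smul_mem _ _ (Submodule.subset_span ?_)
        rw [Finsupp.support_filter, Finset.mem_filter] at hi
        exact ⟨i, hi.2, rfl⟩
    have : (⟨x, hx⟩ : N) = z := Subtype.ext ((hxy.trans (by rw [hy'0, add_zero])).trans hzy.symm)
    rw [this]
    exact hz
  exact ⟨Module.Basis.mk hli hsp, fun i => by rw [Module.Basis.mk_apply]⟩

namespace DiagramTower

variable {R : Type*} [CommRing R] [IsDomain R] {A : ℕ → Type*} [∀ r, Ring (A r)]
  [∀ r, Algebra R (A r)] {Λ : ℕ → Type*} [∀ r, PartialOrder (Λ r)] [∀ r, Finite (Λ r)]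
  {T : ∀ r, Λ r → Type*} [∀ r lam, Finite (T r lam)] (D : DiagramTower R A Λ T)
  {E : Type*} [CommRing E] [Algebra R E] {r : ℕ}

/-- The family `z` spans, cell by cell, the subquotients of the cell filtration of `A_r^E`. -/
def SpansCells (z : (Σ lam : Λ r, D.Path r lam × D.Path r lam) → E ⊗[R] A r) : Prop :=
  ∀ (lam : Λ r) (x y : D.Path r lam →₀ E),
    D.murphyComb x y ∈ Submodule.span E (z '' {j | j.1 = lam}) ⊔ D.aboveBase E r lam

variable {D} {z : (Σ lam : Λ r, D.Path r lam × D.Path r lam) → E ⊗[R] A r}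

theorem SpansCells.span_le (h : D.SpansCells z) {U : Set (Λ r)} (hU : IsUpperSet U) :
    Submodule.span E (D.murphyBase E r '' {i | i.1 ∈ U}) ≤
      Submodule.span E (z '' {j | j.1 ∈ U}) := by
  refine span_le_of_blockTriangular ?_ hU
  rintro ⟨lam, s, t⟩
  have h1 := h lam (Finsupp.single s 1) (Finsupp.single t 1)
  rw [bilinComb_single_single, ← murphyBase_apply, aboveBase_eq_span] at h1
  exact h1

theorem SpansCells.aboveBase_le (h : D.SpansCells z) (lam : Λ r) :
    D.aboveBase E r lam ≤ Submodule.span E (z '' {j | lam < j.1}) := by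
  rw [aboveBase_eq_span]
  exact h.span_le (isUpperSet_Ioi lam)

theorem SpansCells.span_eq_top (h : D.SpansCells z) : Submodule.span E (Set.range z) = ⊤ := by
  have h1 := h.span_le isUpperSet_univ
  simp only [Set.mem_univ, Set.ofPred_true, Set.image_univ, Module.Basis.span_eq] at h1
  exact top_le_iff.1 h1

theorem SpansCells.linearIndependent (h : D.SpansCells z) : LinearIndependent E z :=
  (D.murphyBase E r).linearIndependent_of_span_eq_top (Equiv.refl _) h.span_eq_top

/-- The basis given by a family that spans the cells. -/
noncomputable def SpansCells.basis (h : D.SpansCells z) :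
    Module.Basis (Σ lam : Λ r, D.Path r lam × D.Path r lam) E (E ⊗[R] A r) :=
  Module.Basis.mk h.linearIndependent h.span_eq_top.ge

theorem SpansCells.basis_apply (h : D.SpansCells z) (i) : h.basis i = z i :=
  Module.Basis.mk_apply _ _ i

theorem spansCells_of_sub_mem {f : ∀ {lam : Λ r}, D.Path r lam → D.Path r lam →₀ E}
    (hf : ∀ lam : Λ r, Submodule.span E (Set.range fun t : D.Path r lam => f t) = ⊤)
    (h : ∀ (lam : Λ r) (s t : D.Path r lam),
      z ⟨lam, s, t⟩ - D.murphyComb (f s) (f t) ∈ D.aboveBase E r lam) : D.SpansCells z := by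
  intro lam x y
  refine LinearMap.map_mem_of_span_eq_top (hf lam) (D.murphyComb x) (fun t => ?_) y
  refine LinearMap.map_mem_of_span_eq_top (hf lam) ((D.murphyComb).flip (f t)) (fun s => ?_) x
  rw [LinearMap.flip_apply, ← sub_sub_cancel (z ⟨lam, s, t⟩) (D.murphyComb (f s) (f t))]
  exact sub_mem (Submodule.mem_sup_left (Submodule.subset_span ⟨⟨lam, s, t⟩, rfl, rfl⟩))
    (Submodule.mem_sup_right (h lam s t))

end DiagramTower

namespace QuotientTower

variable {R : Type*} [CommRing R] [IsDomain R] {A : ℕ → Type*} [∀ r, Ring (A r)]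
  [∀ r, Algebra R (A r)] {Λ : ℕ → Type*} [∀ r, PartialOrder (Λ r)] [∀ r, Finite (Λ r)]
  {T : ∀ r, Λ r → Type*} [∀ r lam, Finite (T r lam)] {D : DiagramTower R A Λ T}
  {S K : Type*} [CommRing S] [Field K] [Algebra R S] [Algebra R K]
  [Algebra S K] [IsScalarTower R S K]
  {Q : ℕ → Type*} [∀ r, Ring (Q r)] [∀ r, Algebra K (Q r)]
  {W : QuotientTower D S K Q} {β : ∀ k, Λ (k + 1) → K ⊗[R] A (k + 1)}

theorem starBase_mTilde {r : ℕ} {lam : Λ r} (s t : D.Path r lam) :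
    D.starBase K r (W.mTilde β s t) = W.mTilde β t s := by
  rw [mTilde, mTilde, D.starBase_mul, D.starBase_mul, D.starBase_starBase, D.starBase_m, mul_assoc]

/-- The modified elements `m̃^lam_{st}` as a family over all pairs of paths. -/
noncomputable def tildeFamily (W : QuotientTower D S K Q)
    (β : ∀ k, Λ (k + 1) → K ⊗[R] A (k + 1)) (r : ℕ)
    (i : Σ lam : Λ r, D.Path r lam × D.Path r lam) : K ⊗[R] A r :=
  W.mTilde β i.2.1 i.2.2

theorem spansCells_tildeFamily (hβ : W.IsModifier β) (r : ℕ) :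
    D.SpansCells (W.tildeFamily β r) :=
  DiagramTower.spansCells_of_sub_mem (f := fun t => D.coordBase K r _ (W.aPath β t))
    (fun lam => span_coordBase_aPath hβ r lam)
    fun lam s t => D.starBase_mul_m_mul_sub_mem lam (W.aPath β s) (W.aPath β t)

open Classical in
/-- The element of `A_r^S` that represents `m̂^lam_{st}`. -/
noncomputable def hat (W : QuotientTower D S K Q) {r : ℕ} {lam : Λ r} (s t : D.Path r lam) :
    S ⊗[R] A r :=
  if t.Perm W.perm then D.starBase S r (W.nPath s) * 1 ⊗ₜ[R] D.dPath t
  else D.starBase S r (1 ⊗ₜ[R] D.dPath s) * W.nPath t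

theorem specMap_starBase_nPath (hβ : W.IsModifier β) {r : ℕ} {lam : Λ r} (s : D.Path r lam) :
    specMap R S K (A r) (D.starBase S r (W.nPath s)) =
      D.starBase K r (W.aPath β s) * 1 ⊗ₜ[R] D.m r lam := by
  rw [D.specMap_starBase, specMap_nPath hβ, D.starBase_mul, D.starBase_m]

theorem specMap_hat (hβ : W.IsModifier β) {r : ℕ} {lam : Λ r} (s t : D.Path r lam) :
    specMap R S K (A r) (W.hat s t) = W.mHat β s t := by
  by_cases ht : t.Perm W.perm
  · rw [hat, if_pos ht, mHat, if_neg (fun h => h.2 ht), map_mul, specMap_starBase_nPath hβ,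
      specMap_one_tmul, mTilde, W.aPath_of_perm β ht]
  · rw [hat, if_neg ht, map_mul, D.specMap_starBase, specMap_one_tmul, specMap_nPath hβ,
      ← mul_assoc]
    by_cases hs : s.Perm W.perm
    · rw [mHat, if_neg (fun h => h.1 hs), mTilde, W.aPath_of_perm β hs]
    · rw [mHat, if_pos ⟨hs, ht⟩]

theorem hat_of_perm {r : ℕ} {lam : Λ r} {s t : D.Path r lam} (hs : s.Perm W.perm)
    (ht : t.Perm W.perm) : W.hat s t = 1 ⊗ₜ[R] D.murphy s t := by
  rw [hat, if_pos ht, W.nPath_of_perm hs, D.starBase_mul, D.starBase_m, D.one_tmul_murphy]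

/-- The elements `m̂^lam_{st}` of `A_r^S` as a family over all pairs of paths. -/
noncomputable def hatFamily (W : QuotientTower D S K Q) (r : ℕ)
    (i : Σ lam : Λ r, D.Path r lam × D.Path r lam) : S ⊗[R] A r :=
  W.hat i.2.1 i.2.2

theorem hat_sub_mem [IsFractionRing S K] (hβ : W.IsModifier β) {r : ℕ} {lam : Λ r}
    (s t : D.Path r lam) :
    W.hat s t - D.murphyComb (open Classical in
      if t.Perm W.perm then W.pathCoord s else Finsupp.single s 1) (W.pathCoord t) ∈
      D.aboveBase S r lam := by
  by_cases ht : t.Perm W.perm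
  · refine D.mem_aboveBase_of_specMap (K := K) ?_
    rw [if_pos ht, map_sub, specMap_hat hβ, mHat, if_neg (fun h => h.2 ht), D.specMap_murphyComb,
      mapRange_pathCoord hβ, mapRange_pathCoord hβ]
    exact D.starBase_mul_m_mul_sub_mem lam (W.aPath β s) (W.aPath β t)
  · have h := starBase_mul_nPath_sub_mem hβ (1 ⊗ₜ[R] D.dPath s) t
    rw [D.coordBase_dPath] at h
    rw [if_neg ht, hat, if_neg ht]
    exact h

/-- For a fixed `t` the left coordinates of `m̂^lam_{st}` are those of `a_s` for all `s`, or those of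
`d_s` for all `s`, and both families span. -/
theorem spansCells_hatFamily [IsFractionRing S K] (hβ : W.IsModifier β) (r : ℕ) :
    D.SpansCells (W.hatFamily r) := by
  intro lam x y
  refine LinearMap.map_mem_of_span_eq_top (span_pathCoord hβ r lam) (D.murphyComb x)
    (fun t => ?_) y
  have key : ∀ s : D.Path r lam, D.murphyComb (open Classical in
      if t.Perm W.perm then W.pathCoord s else Finsupp.single s 1) (W.pathCoord t) ∈
      Submodule.span S (W.hatFamily r '' {j | j.1 = lam}) ⊔ D.aboveBase S r lam := by
    intro s
    rw [← sub_sub_cancel (W.hat s t) (D.murphyComb _ (W.pathCoord t))]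
    exact sub_mem (Submodule.mem_sup_left (Submodule.subset_span ⟨⟨lam, s, t⟩, rfl, rfl⟩))
      (Submodule.mem_sup_right (hat_sub_mem hβ s t))
  by_cases ht : t.Perm W.perm
  · simp only [if_pos ht] at key
    exact LinearMap.map_mem_of_span_eq_top (span_pathCoord hβ r lam)
      ((D.murphyComb).flip (W.pathCoord t)) key x
  · simp only [if_neg ht] at key
    refine LinearMap.map_mem_of_span_eq_top (f := fun s => Finsupp.single s (1 : S)) ?_
      ((D.murphyComb).flip (W.pathCoord t)) key x
    have := (Finsupp.basisSingleOne (R := S) (ι := D.Path r lam)).span_eq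
    simpa only [Finsupp.coe_basisSingleOne] using this

/-! ### The ideal generated by the elements `𝔟_μ` -/

theorem inclBase_mem_span {r : ℕ} {x : S ⊗[R] A r}
    (hx : x ∈ TwoSidedIdeal.span (W.marginalSet r)) :
    D.inclBase S r x ∈ TwoSidedIdeal.span (W.marginalSet (r + 1)) := by
  have h : TwoSidedIdeal.span (W.marginalSet r) ≤
      TwoSidedIdeal.comap (D.inclBase S r) (TwoSidedIdeal.span (W.marginalSet (r + 1))) := by
    rw [TwoSidedIdeal.span_le]
    intro y hy
    exact (TwoSidedIdeal.mem_comap _).2 (TwoSidedIdeal.subset_span (Or.inl ⟨y, hy, rfl⟩))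
  exact (TwoSidedIdeal.mem_comap _).1 (h hx)

theorem nPath_mem_span : ∀ {r : ℕ} {lam : Λ r} {t : D.Path r lam}, ¬ t.Perm W.perm →
    W.nPath t ∈ TwoSidedIdeal.span (W.marginalSet r)
  | _, _, .nil lam, h => absurd (W.perm_zero lam) h
  | _, _, .cons (r := r) (lam := lam) (μ := μ) t e, h => by
    by_cases ht : t.Perm W.perm
    · have hμ : μ ∉ W.perm (r + 1) := fun hμ => h ⟨ht, hμ⟩
      rw [nPath, if_pos ht, if_neg hμ]
      exact TwoSidedIdeal.mul_mem_right _ _ _ (TwoSidedIdeal.subset_span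
        (Or.inr ⟨μ, W.isMarginal_of_perm e ht hμ, rfl⟩))
    · rw [nPath, if_neg ht]
      exact TwoSidedIdeal.mul_mem_left _ _ _ (inclBase_mem_span (nPath_mem_span ht))

variable (W) in
/-- The ideal of `A_r^S` generated by the elements `𝔟_μ` is invariant under the involution. -/
def StarStable (r : ℕ) : Prop :=
  ∀ x ∈ TwoSidedIdeal.span (W.marginalSet r),
    D.starBase S r x ∈ TwoSidedIdeal.span (W.marginalSet r)

/-- A nonpermissible path to a permissible point becomes nonpermissible before its end, so only
the invariance of the ideals at lower levels is needed here. -/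
theorem starBase_nPath_mem_span {r : ℕ} (hst : ∀ k < r, W.StarStable k) {lam : Λ r}
    (hlam : lam ∈ W.perm r) {t : D.Path r lam} (h : ¬ t.Perm W.perm) :
    D.starBase S r (W.nPath t) ∈ TwoSidedIdeal.span (W.marginalSet r) := by
  cases t with
  | nil => exact absurd (W.perm_zero _) h
  | cons t e =>
    have ht : ¬ t.Perm W.perm := fun ht => h ⟨ht, hlam⟩
    rw [nPath, if_neg ht, D.starBase_mul, D.starBase_inclBase]
    exact TwoSidedIdeal.mul_mem_right _ _ _
      (inclBase_mem_span (hst _ (Nat.lt_succ_self _) _ (nPath_mem_span ht)))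

theorem hat_mem_span {r : ℕ} (hst : ∀ k < r, W.StarStable k) {lam : Λ r} {s t : D.Path r lam}
    (h : ¬ (s.Perm W.perm ∧ t.Perm W.perm)) :
    W.hat s t ∈ TwoSidedIdeal.span (W.marginalSet r) := by
  by_cases ht : t.Perm W.perm
  · rw [hat, if_pos ht]
    exact TwoSidedIdeal.mul_mem_right _ _ _
      (starBase_nPath_mem_span hst ht.mem fun hs => h ⟨hs, ht⟩)
  · rw [hat, if_neg ht]
    exact TwoSidedIdeal.mul_mem_left _ _ _ (nPath_mem_span ht)

theorem φ_specMap_of_mem_marginalSet : ∀ {r : ℕ} {x : S ⊗[R] A r}, x ∈ W.marginalSet r →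
    W.φ r (specMap R S K (A r) x) = 0
  | 0, _, h => h.elim
  | r + 1, _, .inl ⟨y, hy, h⟩ => by
    rw [← h, D.specMap_inclBase, W.φ_incl, φ_specMap_of_mem_marginalSet hy, map_zero]
  | r + 1, _, .inr ⟨μ, hμ, h⟩ => by rw [h, W.φ_𝔟 r μ hμ]

theorem φ_specMap_of_mem_span {r : ℕ} {x : S ⊗[R] A r}
    (hx : x ∈ TwoSidedIdeal.span (W.marginalSet r)) : W.φ r (specMap R S K (A r) x) = 0 := by
  have h : TwoSidedIdeal.span (W.marginalSet r) ≤
      TwoSidedIdeal.ker ((W.φ r : K ⊗[R] A r →+* Q r).comp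
        (specMap R S K (A r) : S ⊗[R] A r →+* K ⊗[R] A r)) := by
    rw [TwoSidedIdeal.span_le]
    intro y hy
    exact (TwoSidedIdeal.mem_ker _).2 (φ_specMap_of_mem_marginalSet hy)
  exact (TwoSidedIdeal.mem_ker _).1 (h hx)

/-- If `t` is permissible, then so is `lam`, and `a_s^* m_lam` is in the kernel; otherwise
`m_lam a_t` is. -/
theorem φ_mTilde (hβ : W.IsModifier β) {r : ℕ} (hst : ∀ k < r, W.StarStable k) {lam : Λ r}
    {s t : D.Path r lam} (h : ¬ (s.Perm W.perm ∧ t.Perm W.perm)) :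
    W.φ r (W.mTilde β s t) = 0 := by
  by_cases ht : t.Perm W.perm
  · have h1 := φ_specMap_of_mem_span
      (starBase_nPath_mem_span hst ht.mem fun hs => h ⟨hs, ht⟩)
    rw [mTilde, ← specMap_starBase_nPath hβ, map_mul, h1, zero_mul]
  · have h1 := φ_specMap_of_mem_span (nPath_mem_span ht)
    rw [mTilde, mul_assoc, ← specMap_nPath hβ, map_mul, h1, mul_zero]

/-! ### The kernel over the field -/

theorem natCard_permPair (W : QuotientTower D S K Q) (r : ℕ) :
    Nat.card {i : Σ lam : Λ r, D.Path r lam × D.Path r lam //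
      i.2.1.Perm W.perm ∧ i.2.2.Perm W.perm} =
      ∑ᶠ ν ∈ W.perm r, Nat.card {t : D.Path r ν // t.Perm W.perm} ^ 2 := by
  classical
  have := Fintype.ofFinite (Λ r)
  let e : {i : Σ lam : Λ r, D.Path r lam × D.Path r lam //
      i.2.1.Perm W.perm ∧ i.2.2.Perm W.perm} ≃ Σ lam : Λ r, W.PermPath r lam × W.PermPath r lam :=
    { toFun := fun i => ⟨i.1.1, ⟨i.1.2.1, i.2.1⟩, ⟨i.1.2.2, i.2.2⟩⟩
      invFun := fun i => ⟨⟨i.1, i.2.1.1, i.2.2.1⟩, i.2.1.2, i.2.2.2⟩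
      left_inv := fun _ => rfl
      right_inv := fun _ => rfl }
  rw [Nat.card_congr e, Nat.card_sigma]
  simp only [Nat.card_prod, ← pow_two]
  rw [← finsum_eq_sum_of_fintype]
  refine finsum_congr fun ν => ?_
  by_cases hν : ν ∈ W.perm r
  · rw [finsum_eq_if, if_pos hν]
  · rw [finsum_eq_if, if_neg hν]
    have : IsEmpty (W.PermPath r ν) := ⟨fun t => hν t.2.mem⟩
    rw [Nat.card_of_isEmpty, zero_pow two_ne_zero]

/-- The dimension of `Q_r^K` is the number of pairs of permissible paths, so that of the kernel is
the number of the other pairs. -/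
theorem finrank_ker_φ (W : QuotientTower D S K Q) (r : ℕ) :
    Module.finrank K (LinearMap.ker (W.φ r).toLinearMap) = Nat.card (W.NonpermPair r) := by
  have : Module.Finite K (K ⊗[R] A r) := Module.Finite.of_basis (D.murphyBase K r)
  have h1 := LinearMap.finrank_range_add_finrank_ker (W.φ r).toLinearMap
  have h2 : LinearMap.range (W.φ r).toLinearMap = ⊤ :=
    LinearMap.range_eq_top.2 (W.φ_surjective r)
  have h3 := W.finrank_eq r
  rw [Module.finrank_baseChange, ← natCard_permPair] at h3
  rw [h2, finrank_top, h3, Module.finrank_eq_nat_card_basis (D.murphyBase K r)] at h1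
  classical
  have h4 := Nat.card_congr (Equiv.sumCompl fun i : Σ lam : Λ r, D.Path r lam × D.Path r lam =>
    i.2.1.Perm W.perm ∧ i.2.2.Perm W.perm)
  rw [Nat.card_sum] at h4
  exact Nat.add_left_cancel (h1.trans h4.symm)

/-- The modified elements with a nonpermissible index form a basis of the kernel: they lie in it,
are linearly independent, and their number is its dimension. -/
theorem exists_basis_ker_φ (hβ : W.IsModifier β) {r : ℕ} (hst : ∀ k < r, W.StarStable k) :
    ∃ B : Module.Basis (W.NonpermPair r) K (LinearMap.ker (W.φ r).toLinearMap),
      ∀ i, (B i).1 = W.mTilde β i.1.2.1 i.1.2.2 := by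
  have : Module.Finite K (K ⊗[R] A r) := Module.Finite.of_basis (D.murphyBase K r)
  have := Fintype.ofFinite (W.NonpermPair r)
  let v : W.NonpermPair r → LinearMap.ker (W.φ r).toLinearMap := fun i =>
    ⟨W.mTilde β i.1.2.1 i.1.2.2, LinearMap.mem_ker.2 (φ_mTilde hβ hst i.2)⟩
  have hli : LinearIndependent K v := LinearIndependent.of_comp (Submodule.subtype _)
    ((spansCells_tildeFamily hβ r).linearIndependent.comp _ Subtype.val_injective)
  have hsp := hli.span_eq_top_of_card_eq_finrank'
    (by rw [finrank_ker_φ, Nat.card_eq_fintype_card])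
  exact ⟨Module.Basis.mk hli hsp.ge, fun i => by rw [Module.Basis.mk_apply]⟩

theorem ker_φ_eq_span (hβ : W.IsModifier β) {r : ℕ} (hst : ∀ k < r, W.StarStable k) :
    LinearMap.ker (W.φ r).toLinearMap = Submodule.span K (W.tildeFamily β r ''
      {i | ¬ (i.2.1.Perm W.perm ∧ i.2.2.Perm W.perm)}) := by
  obtain ⟨B, hB⟩ := exists_basis_ker_φ hβ hst
  have h := congrArg (Submodule.map (Submodule.subtype _)) B.span_eq
  rw [Submodule.map_span, Submodule.map_top, Submodule.range_subtype, ← Set.range_comp] at h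
  rw [← h]
  congr 1
  ext x
  constructor
  · rintro ⟨i, rfl⟩
    exact ⟨i.1, i.2, (hB i).symm⟩
  · rintro ⟨i, hi, rfl⟩
    exact ⟨⟨i, hi⟩, hB ⟨i, hi⟩⟩

theorem φ_starBase (hβ : W.IsModifier β) {r : ℕ} (hst : ∀ k < r, W.StarStable k)
    {x : K ⊗[R] A r} (hx : W.φ r x = 0) : W.φ r (D.starBase K r x) = 0 := by
  have h : LinearMap.ker (W.φ r).toLinearMap ≤
      (LinearMap.ker (W.φ r).toLinearMap).comap (D.starBase K r) := by
    conv_lhs => rw [ker_φ_eq_span hβ hst]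
    rw [Submodule.span_le]
    rintro _ ⟨⟨lam, s, t⟩, hi, rfl⟩
    change W.φ r (D.starBase K r (W.mTilde β s t)) = 0
    rw [starBase_mTilde]
    exact φ_mTilde hβ hst fun h => hi h.symm
  exact h hx

/-- The Murphy basis elements of pairs of permissible paths are linearly independent modulo the
kernel. -/
theorem eq_zero_of_mem_span_perm [IsFractionRing S K] (hβ : W.IsModifier β) {r : ℕ}
    (hst : ∀ k < r, W.StarStable k) {x : S ⊗[R] A r}
    (hx : x ∈ Submodule.span S (W.hatFamily r ''
      {i | i.2.1.Perm W.perm ∧ i.2.2.Perm W.perm}))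
    (h0 : W.φ r (specMap R S K (A r) x) = 0) : x = 0 := by
  have h1 : specMap R S K (A r) x ∈ Submodule.span K (W.tildeFamily β r ''
      {i | i.2.1.Perm W.perm ∧ i.2.2.Perm W.perm}) := by
    have h2 := Submodule.mem_map_of_mem (f := (specMap R S K (A r)).toLinearMap) hx
    rw [Submodule.map_span, Set.image_image] at h2
    refine Submodule.span_le_restrictScalars S K _ (Submodule.span_mono ?_ h2)
    rintro _ ⟨⟨lam, s, t⟩, hi, rfl⟩
    refine ⟨⟨lam, s, t⟩, hi, ?_⟩
    change W.mTilde β s t = specMap R S K (A r) (W.hat s t)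
    rw [specMap_hat hβ, mHat, if_neg (fun h => h.1 hi.1)]
  have h2 : specMap R S K (A r) x ∈ LinearMap.ker (W.φ r).toLinearMap := h0
  rw [ker_φ_eq_span hβ hst] at h2
  have hdisj := (spansCells_tildeFamily hβ r).linearIndependent.disjoint_span_image
    (s := {i | i.2.1.Perm W.perm ∧ i.2.2.Perm W.perm})
    (t := {i | ¬ (i.2.1.Perm W.perm ∧ i.2.2.Perm W.perm)})
    (Set.disjoint_left.2 fun i hi hi' => hi' hi)
  exact D.specMap_injective r (by rw [Submodule.disjoint_def.1 hdisj _ h1 h2, map_zero])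

end QuotientTower

/-! ### The kernel over `S` -/

namespace QuotientTower

variable {R : Type*} [CommRing R] [IsDomain R] {A : ℕ → Type*} [∀ r, Ring (A r)]
  [∀ r, Algebra R (A r)] {Λ : ℕ → Type*} [∀ r, PartialOrder (Λ r)] [∀ r, Finite (Λ r)]
  {T : ∀ r, Λ r → Type*} [∀ r lam, Finite (T r lam)] {D : DiagramTower R A Λ T}
  {S K : Type*} [CommRing S] [Field K] [Algebra R S] [Algebra R K]
  [Algebra S K] [IsScalarTower R S K]
  {Q : ℕ → Type*} [∀ r, Ring (Q r)] [∀ r, Algebra K (Q r)] [∀ r, Algebra S (Q r)]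
  [∀ r, IsScalarTower S K (Q r)]
  {W : QuotientTower D S K Q} {β : ∀ k, Λ (k + 1) → K ⊗[R] A (k + 1)}

theorem φS_apply (r : ℕ) (x : S ⊗[R] A r) : W.φS r x = W.φ r (specMap R S K (A r) x) := rfl

theorem φS_starBase (hβ : W.IsModifier β) {r : ℕ} (hst : ∀ k < r, W.StarStable k)
    {x : S ⊗[R] A r} (hx : W.φS r x = 0) : W.φS r (D.starBase S r x) = 0 := by
  rw [φS_apply, D.specMap_starBase]
  exact φ_starBase hβ hst hx

variable (W) in
/-- The surjection from `A_r^S` to `Q_r^S`. -/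
noncomputable abbrev toRange (r : ℕ) : S ⊗[R] A r →ₐ[S] (W.φS r).range := (W.φS r).rangeRestrict

theorem toRange_surjective (r : ℕ) : Function.Surjective (W.toRange r) :=
  (W.φS r).rangeRestrict_surjective

theorem toRange_eq_zero {r : ℕ} {x : S ⊗[R] A r} : W.toRange r x = 0 ↔ W.φS r x = 0 := by
  rw [← Subtype.coe_inj]
  rfl

variable [IsFractionRing S K]

theorem exists_basis_ker_φS (hβ : W.IsModifier β) {r : ℕ} (hst : ∀ k < r, W.StarStable k) :
    ∃ B : Module.Basis (W.NonpermPair r) S (LinearMap.ker (W.φS r).toLinearMap),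
      ∀ i, (B i).1 = W.hat i.1.2.1 i.1.2.2 := by
  have h := (spansCells_hatFamily hβ r).basis.exists_basis_submodule
    (fun i => ¬ (i.2.1.Perm W.perm ∧ i.2.2.Perm W.perm)) (LinearMap.ker (W.φS r).toLinearMap) ?_ ?_
  · obtain ⟨B, hB⟩ := h
    exact ⟨B, fun i => (hB i).trans (DiagramTower.SpansCells.basis_apply _ _)⟩
  · intro i hi
    rw [DiagramTower.SpansCells.basis_apply]
    exact φ_specMap_of_mem_span (hat_mem_span hst hi)
  · intro x hx hx'
    refine eq_zero_of_mem_span_perm hβ hst (Submodule.span_mono ?_ hx') hx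
    rintro _ ⟨i, hi, rfl⟩
    exact ⟨i, not_not.1 hi, (DiagramTower.SpansCells.basis_apply _ _).symm⟩

theorem φS_eq_zero_iff (hβ : W.IsModifier β) {r : ℕ} (hst : ∀ k < r, W.StarStable k)
    (x : S ⊗[R] A r) : W.φS r x = 0 ↔ x ∈ TwoSidedIdeal.span (W.marginalSet r) := by
  refine ⟨fun hx => ?_, fun hx => φ_specMap_of_mem_span hx⟩
  obtain ⟨B, hB⟩ := exists_basis_ker_φS hβ hst
  have h := B.linearCombination_repr ⟨x, hx⟩
  have h2 := congrArg (Submodule.subtype _) h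
  rw [Finsupp.linearCombination_apply, Finsupp.sum, map_sum] at h2
  change _ = x at h2
  rw [← h2]
  refine sum_mem fun i _ => ?_
  rw [map_smul, Submodule.subtype_apply, hB, Algebra.smul_def]
  exact TwoSidedIdeal.mul_mem_left _ _ _ (hat_mem_span hst i.2)

/-- The ideal generated by the elements `𝔟_μ` coincides with the kernel, so it is invariant under
the involution at every level. -/
theorem starStable (hβ : W.IsModifier β) (r : ℕ) : W.StarStable r := by
  induction r using Nat.strong_induction_on with
  | _ r hst =>
  intro x hx
  rw [← φS_eq_zero_iff hβ hst] at hx ⊢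
  exact φS_starBase hβ hst hx

theorem exists_basis_ker_φS_mTilde (hβ : W.IsModifier β) (r : ℕ)
    (hint : ∀ (lam : Λ r) (s t : D.Path r lam), ¬ s.Perm W.perm → ¬ t.Perm W.perm →
      ∃ x : S ⊗[R] A r, specMap R S K (A r) x = W.mTilde β s t) :
    ∃ B : Module.Basis (W.NonpermPair r) S (LinearMap.ker (W.φS r).toLinearMap),
      ∀ i, specMap R S K (A r) (B i).1 = W.mTilde β i.1.2.1 i.1.2.2 := by
  have hint' : ∀ i : Σ lam : Λ r, D.Path r lam × D.Path r lam,
      ∃ x : S ⊗[R] A r, specMap R S K (A r) x = W.mTilde β i.2.1 i.2.2 := by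
    rintro ⟨lam, s, t⟩
    by_cases h : ¬ s.Perm W.perm ∧ ¬ t.Perm W.perm
    · exact hint lam s t h.1 h.2
    · exact ⟨W.hat s t, by rw [specMap_hat hβ, mHat, if_neg h]⟩
  choose z hz using hint'
  have hcells : D.SpansCells z := by
    refine DiagramTower.spansCells_of_sub_mem (f := fun t => W.pathCoord t)
      (fun lam => span_pathCoord hβ r lam) fun lam s t => ?_
    refine D.mem_aboveBase_of_specMap (K := K) ?_
    rw [map_sub, hz, D.specMap_murphyComb, mapRange_pathCoord hβ, mapRange_pathCoord hβ]
    exact D.starBase_mul_m_mul_sub_mem lam (W.aPath β s) (W.aPath β t)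
  have h := hcells.basis.exists_basis_submodule
    (fun i => ¬ (i.2.1.Perm W.perm ∧ i.2.2.Perm W.perm)) (LinearMap.ker (W.φS r).toLinearMap) ?_ ?_
  · obtain ⟨B, hB⟩ := h
    exact ⟨B, fun i => by rw [hB, DiagramTower.SpansCells.basis_apply, hz]⟩
  · intro i hi
    rw [DiagramTower.SpansCells.basis_apply]
    change W.φ r (specMap R S K (A r) (z i)) = 0
    rw [hz]
    exact φ_mTilde hβ (fun k _ => starStable hβ k) hi
  · intro x hx hx'
    refine eq_zero_of_mem_span_perm hβ (fun k _ => starStable hβ k)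
      (Submodule.span_mono ?_ hx') hx
    rintro _ ⟨⟨lam, s, t⟩, hi, rfl⟩
    have hi' := not_not.1 hi
    refine ⟨⟨lam, s, t⟩, hi', D.specMap_injective (K := K) r ?_⟩
    rw [DiagramTower.SpansCells.basis_apply, hz]
    change specMap R S K (A r) (W.hat s t) = _
    rw [specMap_hat hβ, mHat, if_neg (fun h => h.1 hi'.1)]

/-! ### The cell datum of the quotient -/

theorem toRange_hat_of_not_perm {r : ℕ} (hβ : W.IsModifier β) {lam : Λ r} {s t : D.Path r lam}
    (h : ¬ (s.Perm W.perm ∧ t.Perm W.perm)) : W.toRange r (W.hat s t) = 0 :=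
  toRange_eq_zero.2 (φ_specMap_of_mem_span (hat_mem_span (fun k _ => starStable hβ k) h))

variable (W) in
/-- The images in `Q_r^S` of the Murphy basis elements of pairs of permissible paths. -/
noncomputable def permFamily (r : ℕ)
    (i : Σ lam : {lam : Λ r // lam ∈ W.perm r}, W.PermPath r lam.1 × W.PermPath r lam.1) :
    (W.φS r).range :=
  W.toRange r (1 ⊗ₜ[R] D.murphy i.2.1.1 i.2.2.1)

theorem linearIndependent_permFamily (hβ : W.IsModifier β) (r : ℕ) :
    LinearIndependent S (W.permFamily r) := by
  let g : (Σ lam : {lam : Λ r // lam ∈ W.perm r}, W.PermPath r lam.1 × W.PermPath r lam.1) →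
      Σ lam : Λ r, D.Path r lam × D.Path r lam := fun i => ⟨i.1.1, i.2.1.1, i.2.2.1⟩
  have hg : Function.Injective g := by
    rintro ⟨⟨lam, h⟩, ⟨s, hs⟩, ⟨t, ht⟩⟩ ⟨⟨lam', h'⟩, ⟨s', hs'⟩, ⟨t', ht'⟩⟩ heq
    cases heq
    rfl
  have h1 := (spansCells_hatFamily hβ r).linearIndependent.comp g hg
  have h2 : Disjoint (Submodule.span S (Set.range (W.hatFamily r ∘ g)))
      (LinearMap.ker (W.toRange r).toLinearMap) := by
    rw [Submodule.disjoint_def]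
    intro x hx h0
    refine eq_zero_of_mem_span_perm hβ (fun k _ => starStable hβ k) (Submodule.span_mono ?_ hx)
      (toRange_eq_zero.1 h0)
    rintro _ ⟨i, rfl⟩
    exact ⟨g i, ⟨i.2.1.2, i.2.2.2⟩, rfl⟩
  have h3 : W.permFamily r = (W.toRange r).toLinearMap ∘ W.hatFamily r ∘ g := by
    funext i
    change _ = W.toRange r (W.hat i.2.1.1 i.2.2.1)
    rw [hat_of_perm i.2.1.2 i.2.2.2]
    rfl
  rw [h3]
  exact h1.map h2

theorem toRange_mem_span (hβ : W.IsModifier β) {r : ℕ} {U : Set (Λ r)} {x : S ⊗[R] A r}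
    (hx : x ∈ Submodule.span S (W.hatFamily r '' {j | j.1 ∈ U})) :
    W.toRange r x ∈ Submodule.span S (W.permFamily r '' {i | i.1.1 ∈ U}) := by
  have h : Submodule.span S (W.hatFamily r '' {j | j.1 ∈ U}) ≤
      (Submodule.span S (W.permFamily r '' {i | i.1.1 ∈ U})).comap (W.toRange r).toLinearMap := by
    rw [Submodule.span_le]
    rintro _ ⟨⟨lam, s, t⟩, hU, rfl⟩
    change W.toRange r (W.hat s t) ∈ Submodule.span S (W.permFamily r '' {i | i.1.1 ∈ U})
    by_cases hi : s.Perm W.perm ∧ t.Perm W.perm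
    · rw [hat_of_perm hi.1 hi.2]
      exact Submodule.subset_span ⟨⟨⟨lam, hi.1.mem⟩, ⟨s, hi.1⟩, ⟨t, hi.2⟩⟩, hU, rfl⟩
    · rw [toRange_hat_of_not_perm hβ hi]
      exact zero_mem _
  exact h hx

theorem span_permFamily (hβ : W.IsModifier β) (r : ℕ) :
    Submodule.span S (Set.range (W.permFamily r)) = ⊤ := by
  rw [eq_top_iff]
  intro y _
  obtain ⟨x, rfl⟩ := toRange_surjective r y
  have hx : x ∈ Submodule.span S (W.hatFamily r '' {j | j.1 ∈ Set.univ}) := by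
    simp only [Set.mem_univ, Set.ofPred_true, Set.image_univ,
      (spansCells_hatFamily hβ r).span_eq_top, Submodule.mem_top]
  exact Submodule.span_mono (Set.image_subset_range _ _) (toRange_mem_span hβ hx)

/-- The basis of `Q_r^S` that consists of the images of the Murphy basis elements of pairs of
permissible paths. -/
noncomputable def permBasis (hβ : W.IsModifier β) (r : ℕ) : Module.Basis
    (Σ lam : {lam : Λ r // lam ∈ W.perm r}, W.PermPath r lam.1 × W.PermPath r lam.1) S
    (W.φS r).range :=
  Module.Basis.mk (linearIndependent_permFamily hβ r) (span_permFamily hβ r).ge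

theorem permBasis_apply (hβ : W.IsModifier β) (r : ℕ) (i) :
    permBasis hβ r i = W.permFamily r i :=
  Module.Basis.mk_apply _ _ i

/-- The involution of `Q_r^S`. -/
noncomputable def rangeStar (hβ : W.IsModifier β) (r : ℕ) :
    (W.φS r).range →ₗ[S] (W.φS r).range :=
  have h : ∀ x x', W.toRange r x = W.toRange r x' →
      W.toRange r (D.starBase S r x) = W.toRange r (D.starBase S r x') := fun x x' hxx => by
    rw [← sub_eq_zero, ← map_sub, ← map_sub] at *
    exact toRange_eq_zero.2 (φS_starBase hβ (fun k _ => starStable hβ k) (toRange_eq_zero.1 hxx))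
  have hinv := Function.surjInv_eq (toRange_surjective (W := W) r)
  { toFun := fun y => W.toRange r (D.starBase S r (Function.surjInv (toRange_surjective r) y))
    map_add' := fun y y' => by
      rw [← map_add, ← map_add]
      exact h _ _ (by rw [map_add, hinv, hinv, hinv])
    map_smul' := fun c y => by
      rw [RingHom.id_apply, ← map_smul, ← map_smul]
      exact h _ _ (by rw [map_smul, hinv, hinv]) }

theorem rangeStar_toRange (hβ : W.IsModifier β) (r : ℕ) (x : S ⊗[R] A r) :
    rangeStar hβ r (W.toRange r x) = W.toRange r (D.starBase S r x) := by
  have h := Function.surjInv_eq (toRange_surjective (W := W) r) (W.toRange r x)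
  rw [← sub_eq_zero, ← map_sub] at h
  change W.toRange r (D.starBase S r (Function.surjInv (toRange_surjective r) _)) = _
  rw [← sub_eq_zero, ← map_sub, ← map_sub]
  exact toRange_eq_zero.2 (φS_starBase hβ (fun k _ => starStable hβ k) (toRange_eq_zero.1 h))

/-- The basis of the cell module `Δ(lam)` over `S` that consists of the vectors
`δ(lam) a_t`. -/
noncomputable def pathCoordBasis (hβ : W.IsModifier β) (r : ℕ) (lam : Λ r) :
    Module.Basis (D.Path r lam) S (D.Path r lam →₀ S) :=
  Module.Basis.mk (v := fun t => W.pathCoord t)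
    (Finsupp.basisSingleOne.linearIndependent_of_span_eq_top (Equiv.refl _)
      (span_pathCoord hβ r lam)) (span_pathCoord hβ r lam).ge

theorem _root_.Finsupp.linearCombination_subtypeDomain {E V ι : Type*} [CommSemiring E]
    [AddCommMonoid V] [Module E V] {p : ι → Prop} {g : ι → V} (hg : ∀ i, ¬ p i → g i = 0)
    (c : ι →₀ E) :
    Finsupp.linearCombination E (fun i : Subtype p => g i) (c.subtypeDomain p) =
      Finsupp.linearCombination E g c := by
  classical
  induction c using Finsupp.induction_linear with
  | zero => simp
  | add c c' h h' => rw [Finsupp.subtypeDomain_add, map_add, map_add, h, h']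
  | single i a =>
    by_cases hi : p i
    · have : (Finsupp.single i a).subtypeDomain p = Finsupp.single ⟨i, hi⟩ a := by
        ext j
        simp [Finsupp.single_apply, Subtype.ext_iff]
      rw [this]
      simp
    · have : (Finsupp.single i a).subtypeDomain p = 0 := by
        ext j
        have : i ≠ j.1 := fun h => hi (h ▸ j.2)
        simp [this]
      rw [this]
      simp [hg i hi]

/-- Products in `Q_r^S` of Murphy basis elements with arbitrary elements: the terms with a
nonpermissible path vanish once `δ(lam) d_t x` is expanded in the basis `δ(lam) a_v`. -/
theorem toRange_murphy_mul_sub_mem (hβ : W.IsModifier β) {r : ℕ} {lam : Λ r}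
    (s t : W.PermPath r lam) (x : S ⊗[R] A r) :
    W.toRange r (1 ⊗ₜ[R] D.murphy s.1 t.1) * W.toRange r x -
      Finsupp.linearCombination S
        (fun v : W.PermPath r lam => W.toRange r (1 ⊗ₜ[R] D.murphy s.1 v.1))
        (((pathCoordBasis hβ r lam).repr
          (D.coordBase S r lam (1 ⊗ₜ[R] D.dPath t.1 * x))).subtypeDomain fun v => v.Perm W.perm) ∈
      Submodule.span S (W.permFamily r '' {i | i.1.1 ∈ Set.Ioi lam}) := by
  set c := (pathCoordBasis hβ r lam).repr (D.coordBase S r lam (1 ⊗ₜ[R] D.dPath t.1 * x)) with hc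
  let g : D.Path r lam → S ⊗[R] A r := fun v =>
    D.starBase S r (1 ⊗ₜ[R] D.dPath s.1) * W.nPath v
  have h1 : (1 ⊗ₜ[R] D.murphy s.1 t.1 * x : S ⊗[R] A r) -
      Finsupp.linearCombination S g c ∈ D.aboveBase S r lam := by
    have h2 := D.starBase_mul_m_mul_sub_mem lam (1 ⊗ₜ[R] D.dPath s.1)
      ((1 : S) ⊗ₜ[R] D.dPath t.1 * x)
    rw [← mul_assoc, ← D.one_tmul_murphy, D.coordBase_dPath] at h2
    have h3 : D.coordBase S r lam (1 ⊗ₜ[R] D.dPath t.1 * x) =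
        Finsupp.linearCombination S (fun v => W.pathCoord v) c := by
      have hb : ⇑(pathCoordBasis hβ r lam) = fun v => W.pathCoord v := Module.Basis.coe_mk _ _
      rw [← hb, hc, Module.Basis.linearCombination_repr]
    have h4 : Finsupp.linearCombination S g c - D.murphyComb (Finsupp.single s.1 1)
        (Finsupp.linearCombination S (fun v => W.pathCoord v) c) ∈ D.aboveBase S r lam := by
      rw [Finsupp.apply_linearCombination, Finsupp.linearCombination_apply,
        Finsupp.linearCombination_apply, Finsupp.sum, Finsupp.sum, ← Finset.sum_sub_distrib]
      refine Submodule.sum_mem _ fun v _ => ?_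
      rw [← smul_sub]
      refine Submodule.smul_mem _ _ ?_
      have h5 := starBase_mul_nPath_sub_mem hβ (1 ⊗ₜ[R] D.dPath s.1) v
      rw [D.coordBase_dPath] at h5
      exact h5
    rw [h3] at h2
    convert sub_mem h2 h4 using 1
    abel
  have h2 := toRange_mem_span hβ ((spansCells_hatFamily hβ r).aboveBase_le lam h1)
  rw [map_sub, map_mul] at h2
  have h3 : W.toRange r (Finsupp.linearCombination S g c) =
      Finsupp.linearCombination S (fun v => W.toRange r (g v)) c :=
    Finsupp.apply_linearCombination S (W.toRange r).toLinearMap g c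
  rw [h3, ← Finsupp.linearCombination_subtypeDomain (p := fun v => v.Perm W.perm)] at h2
  · have h4 : (fun v : W.PermPath r lam => W.toRange r (g v.1)) =
        fun v => W.toRange r (1 ⊗ₜ[R] D.murphy s.1 v.1) := by
      funext v
      change W.toRange r (D.starBase S r (1 ⊗ₜ[R] D.dPath s.1) * W.nPath v.1) = _
      rw [W.nPath_of_perm v.2, ← mul_assoc, ← D.one_tmul_murphy]
    rw [h4] at h2
    exact h2
  · intro v hv
    rw [toRange_eq_zero]
    exact φ_specMap_of_mem_span (TwoSidedIdeal.mul_mem_left _ _ _ (nPath_mem_span hv))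

/-- The cell datum of `Q_r^S`. -/
noncomputable def rangeDatum (hβ : W.IsModifier β) (r : ℕ) :
    CellDatum S (W.φS r).range {lam : Λ r // lam ∈ W.perm r} (fun lam => W.PermPath r lam.1) where
  star := rangeStar hβ r
  star_mul x y := by
    obtain ⟨x, rfl⟩ := toRange_surjective r x
    obtain ⟨y, rfl⟩ := toRange_surjective r y
    rw [← map_mul, rangeStar_toRange, rangeStar_toRange, rangeStar_toRange, D.starBase_mul, map_mul]
  star_star x := by
    obtain ⟨x, rfl⟩ := toRange_surjective r x
    rw [rangeStar_toRange, rangeStar_toRange, D.starBase_starBase]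
  basis := permBasis hβ r
  coef lam y t := ((pathCoordBasis hβ r lam.1).repr (D.coordBase S r lam.1
    (1 ⊗ₜ[R] D.dPath t.1 * Function.surjInv (toRange_surjective r) y))).subtypeDomain
      fun v => v.Perm W.perm
  mul_coef lam y s t := by
    have h := toRange_murphy_mul_sub_mem hβ s t (Function.surjInv (toRange_surjective r) y)
    rw [Function.surjInv_eq (toRange_surjective r) y] at h
    simp only [permBasis_apply]
    refine Submodule.span_mono ?_ h
    rintro _ ⟨⟨μ, p, q⟩, hμ, rfl⟩
    exact ⟨μ, hμ, p, q, rfl⟩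
  star_basis lam s t := by
    simp only [permBasis_apply, permFamily]
    rw [rangeStar_toRange, D.starBase_murphy, sub_self]
    exact zero_mem _

end QuotientTower

theorem mainTheorem5 {R : Type*} [CommRing R] [IsDomain R]
    {A : ℕ → Type*} [∀ r, Ring (A r)] [∀ r, Algebra R (A r)]
    {Λ : ℕ → Type*} [∀ r, PartialOrder (Λ r)] [∀ r, Finite (Λ r)]
    {T : ∀ r, Λ r → Type*} [∀ r lam, Finite (T r lam)]
    (D : DiagramTower R A Λ T)
    {S K : Type*} [CommRing S] [IsDomain S] [Field K] [Algebra R S] [Algebra R K] [Algebra S K]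
    [IsScalarTower R S K] [IsFractionRing S K]
    (hπ : Function.Surjective (algebraMap R S))
    {Q : ℕ → Type*} [∀ r, Ring (Q r)] [∀ r, Algebra K (Q r)] [∀ r, Algebra S (Q r)]
    [∀ r, IsScalarTower S K (Q r)]
    (W : QuotientTower D S K Q)
    (β : ∀ k, Λ (k + 1) → K ⊗[R] A (k + 1))
    (hβ : ∀ k μ, D.IsMarginal W.perm k μ →
      specMap R S K _ (W.𝔟 k μ) = 1 ⊗ₜ[R] D.m (k + 1) μ * β k μ)
    (r : ℕ) :
    -- the kernel of `φ_r` on `A_r^K` and on `A_r^S` is invariant under the involution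
    ((∀ x : K ⊗[R] A r, W.φ r x = 0 → W.φ r (D.starBase K r x) = 0) ∧
      (∀ x : S ⊗[R] A r, W.φS r x = 0 → W.φS r (D.starBase S r x) = 0)) ∧
    -- the cell datum of `Q_r^S`
    (∃ E : CellDatum S (W.φS r).range {lam : Λ r // lam ∈ W.perm r}
        (fun lam => W.PermPath r lam.1),
      (∀ x : S ⊗[R] A r,
        E.star ((W.φS r).rangeRestrict x) = (W.φS r).rangeRestrict (D.starBase S r x)) ∧
      (∀ (lam : {lam : Λ r // lam ∈ W.perm r}) (s t : W.PermPath r lam.1),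
        E.c lam s t = (W.φS r).rangeRestrict (1 ⊗ₜ[R] D.murphy s.1 t.1))) ∧
    -- the bases of the kernel, over `S` and over `K`
    ((∃ B : Module.Basis (W.NonpermPair r) S (LinearMap.ker (W.φS r).toLinearMap),
        ∀ i, specMap R S K (A r) (B i).1 = W.mHat β i.1.2.1 i.1.2.2) ∧
      (∃ B : Module.Basis (W.NonpermPair r) K (LinearMap.ker (W.φ r).toLinearMap),
        ∀ i, (B i).1 = W.mTilde β i.1.2.1 i.1.2.2) ∧
      ((∀ (lam : Λ r) (s t : D.Path r lam), ¬ s.Perm W.perm → ¬ t.Perm W.perm →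
          ∃ x : S ⊗[R] A r, specMap R S K (A r) x = W.mTilde β s t) →
        ∃ B : Module.Basis (W.NonpermPair r) S (LinearMap.ker (W.φS r).toLinearMap),
          ∀ i, specMap R S K (A r) (B i).1 = W.mTilde β i.1.2.1 i.1.2.2)) ∧
    -- the kernel is generated by the elements `𝔟_μ`, for `μ` marginal
    (∀ x : S ⊗[R] A r, W.φS r x = 0 ↔ x ∈ TwoSidedIdeal.span (W.marginalSet r)) := by
  have hmod : W.IsModifier β := hβ
  have hst : ∀ k < r, W.StarStable k := fun k _ => QuotientTower.starStable hmod k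
  refine ⟨⟨fun x => QuotientTower.φ_starBase hmod hst, fun x => QuotientTower.φS_starBase hmod hst⟩,
    ⟨QuotientTower.rangeDatum hmod r, QuotientTower.rangeStar_toRange hmod r, fun lam s t => ?_⟩,
    ⟨?_, QuotientTower.exists_basis_ker_φ hmod hst,
      QuotientTower.exists_basis_ker_φS_mTilde hmod r⟩,
    QuotientTower.φS_eq_zero_iff hmod hst⟩
  · exact QuotientTower.permBasis_apply hmod r ⟨lam, s, t⟩
  · obtain ⟨B, hB⟩ := QuotientTower.exists_basis_ker_φS hmod hst
    exact ⟨B, fun i => by rw [hB, QuotientTower.specMap_hat hmod]⟩
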